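/- For $f\in L^2(\mathbb R)$ let $\hat f(\xi)=\int_{\mathbb R} e^{-ix\xi}f(x)\,dx$ (in the $L^2$ sense), let $\|f\|_{H^s(\mathbb R)}=\|(1+\xi^2)^{s/2}\hat f(\xi)\|_{L^2(\mathbb R)}$, and put $$e^{it\Delta}f(x)=\frac1{2\pi}\lim_{R\to\infty}\int_{-R}^{R}e^{ix\xi+it\xi^2}\hat f(\xi)\,d\xi$$ wherever the limit exists. Let $0<\alpha<1$, $C_1\ge 1$, $C_2>0$, $x_0\in\mathbb R$, $r>0$ and $B(x_0,r)=(x_0-r,x_0+r)$. Let $\gamma:\mathbb R\times[0,1]\to\mathbb R$ satisfy, for all $x,y\in B(x_0,r)$ and $t,t'\in[0,1]$, $\gamma(x,0)=x$, $$C_1^{-1}|x-y|\le|\gamma(x,t)-\gamma(y,t)|\le C_1|x-y|,\qquad |\gamma(x,t)-\gamma(x,t')|\le C_2|t-t'|^{\alpha}.$$ Let $s\in\mathbb R$ and $p>0$ satisfy one of the following: (1) $\alpha\in[1/2,1)$, $s>1/4$ and $p\le4$; (2) $\alpha\in(1/4,1/2)$, $s>1/4$ and $p\le8\alpha$; (3)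 $\alpha\in(0,1/4]$, $s>1/2-\alpha$ and $p\le2$. Then there is a constant $C$, depending only on $\alpha,s,p,C_1,C_2$ and $B(x_0,r)$ (and not on $\gamma$ or $f$), such that for every $f\in H^s(\mathbb R)$ the following holds: for almost every $x\in B(x_0,r)$ the value $e^{it\Delta}f(\gamma(x,t))$ exists for all $t\in(0,1)$, the function $x\mapsto\sup_{0<t<1}|e^{it\Delta}f(\gamma(x,t))|$ is measurable on $B(x_0,r)$ (up to a null set), and $$\Bigl\|\sup_{0<t<1}|e^{it\Delta}f(\gamma(x,t))|\Bigr\|_{L^p(B(x_0,r))}\le C\,\|f\|_{H^s(\mathbb R)}.$$ -/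

import Mathlib

open MeasureTheory Filter Topology
open scoped NNReal ENNReal FourierTransform

noncomputable section

namespace TangentialSchrodinger

/-- The Fourier transform `f̂(ξ) = ∫ e^{-ixξ} f(x) dx` of `f ∈ L²(ℝ)` (a representative of the
`L²` class). Mathlib's `𝓕` has the kernel `e^{-2πixξ}`, hence the rescaling. -/
def fhat (f : Lp ℂ 2 (volume : Measure ℝ)) (ξ : ℝ) : ℂ :=
  (𝓕 f : Lp ℂ 2 (volume : Measure ℝ)) (ξ / (2 * Real.pi))

/-- `f ∈ H^s(ℝ)`, where `s ≥ 0`, so that `H^s(ℝ) ⊆ L²(ℝ)`. -/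
def MemH (s : ℝ) (f : Lp ℂ 2 (volume : Measure ℝ)) : Prop :=
  TemperedDistribution.MemSobolev s 2 (Lp.toTemperedDistribution f)

/-- `‖f‖_{H^s(ℝ)} = ‖(1 + ξ²)^{s/2} f̂(ξ)‖_{L²}`. -/
def normH (s : ℝ) (f : Lp ℂ 2 (volume : Measure ℝ)) : ℝ≥0∞ :=
  eLpNorm (fun ξ : ℝ => (((1 + ξ ^ 2) ^ (s / 2) : ℝ) : ℂ) * fhat f ξ) 2 volume

/-- The truncated integral `(2π)⁻¹ ∫_{-R}^{R} e^{ixξ + itξ²} f̂(ξ) dξ`. -/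
def schrodingerTrunc (f : Lp ℂ 2 (volume : Measure ℝ)) (t x R : ℝ) : ℂ :=
  (2 * Real.pi : ℂ)⁻¹ *
    ∫ ξ in (-R)..R, Complex.exp (Complex.I * ((x * ξ + t * ξ ^ 2 : ℝ) : ℂ)) * fhat f ξ

/-- `e^{itΔ} f(x) = (2π)⁻¹ ∫ e^{ixξ + itξ²} f̂(ξ) dξ`. For `f ∈ H^s` with `s ≤ 1/2` the function
`f̂` need not be integrable, so the integral is the limit of its truncations; where `f̂` is
integrable this is the Lebesgue integral. -/
def schrodinger (f : Lp ℂ 2 (volume : Measure ℝ)) (t x : ℝ) : ℂ :=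
  limUnder atTop (schrodingerTrunc f t x)

/-- The maximal function `sup_{0 < t < 1} |e^{itΔ} f(γ(x,t))|`, with values in `[0,∞]`. -/
def maximalFunction (γ : ℝ → ℝ → ℝ) (f : Lp ℂ 2 (volume : Measure ℝ)) (x : ℝ) : ℝ≥0∞ :=
  ⨆ t ∈ Set.Ioo (0 : ℝ) 1, ‖schrodinger f t (γ x t)‖ₑ

/-- On `B(x₀,r) × [0,1]`, the map `γ` starts at the identity, is bi-Lipschitz in `x` with
constant `C₁` and Hölder continuous of order `α` in `t` with constant `C₂`. -/
structure IsTangentialCurve (α C₁ C₂ x₀ r : ℝ) (γ : ℝ → ℝ → ℝ) : Prop where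
  start : ∀ x ∈ Metric.ball x₀ r, γ x 0 = x
  lower : ∀ x ∈ Metric.ball x₀ r, ∀ y ∈ Metric.ball x₀ r, ∀ t ∈ Set.Icc (0 : ℝ) 1,
    C₁⁻¹ * |x - y| ≤ |γ x t - γ y t|
  upper : ∀ x ∈ Metric.ball x₀ r, ∀ y ∈ Metric.ball x₀ r, ∀ t ∈ Set.Icc (0 : ℝ) 1,
    |γ x t - γ y t| ≤ C₁ * |x - y|
  holder : ∀ x ∈ Metric.ball x₀ r, ∀ t ∈ Set.Icc (0 : ℝ) 1, ∀ t' ∈ Set.Icc (0 : ℝ) 1,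
    |γ x t - γ x t'| ≤ C₂ * |t - t'| ^ α

/-- The maximal estimate on `L^p(B(x₀,r))` for all `f ∈ H^s(ℝ)`, with a constant `C` that does
not depend on `f`, nor on `γ` within the class given by `α, C₁, C₂` and the ball. It includes that
the left-hand side makes sense: for almost every `x` the values `e^{itΔ} f(γ(x,t))` exist for all
`t`, and the maximal function is measurable. -/
def MaximalEstimate (α C₁ C₂ x₀ r s p : ℝ) : Prop :=
  ∃ C : ℝ≥0, ∀ γ : ℝ → ℝ → ℝ, IsTangentialCurve α C₁ C₂ x₀ r γ →
    ∀ f : Lp ℂ 2 (volume : Measure ℝ), MemH s f →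
      (∀ᵐ x ∂(volume.restrict (Metric.ball x₀ r)), ∀ t ∈ Set.Ioo (0 : ℝ) 1,
        Tendsto (schrodingerTrunc f t (γ x t)) atTop (𝓝 (schrodinger f t (γ x t)))) ∧
      AEMeasurable (maximalFunction γ f) (volume.restrict (Metric.ball x₀ r)) ∧
      eLpNorm (maximalFunction γ f) (ENNReal.ofReal p) (volume.restrict (Metric.ball x₀ r))
        ≤ C * normH s f

end TangentialSchrodinger

end

open MeasureTheory Filter Topology
open scoped NNReal ENNReal FourierTransform

noncomputable section

namespace TangentialSchrodinger

/-- The unimodular factor `e^{i(aξ + τξ²)}`. -/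
def chirp (a τ ξ : ℝ) : ℂ := Complex.exp (Complex.I * ((a * ξ + τ * ξ ^ 2 : ℝ) : ℂ))

lemma norm_chirp (a τ ξ : ℝ) : ‖chirp a τ ξ‖ = 1 := by
  rw [chirp, mul_comm, Complex.norm_exp_ofReal_mul_I]

lemma continuous_chirp : Continuous fun q : ℝ × ℝ × ℝ => chirp q.1 q.2.1 q.2.2 := by
  unfold chirp
  fun_prop

@[fun_prop]
lemma continuous_chirp_right (a τ : ℝ) : Continuous (chirp a τ) := by
  unfold chirp
  fun_prop

lemma chirp_neg_right (a τ ξ : ℝ) : chirp a τ (-ξ) = chirp (-a) τ ξ := by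
  simp [chirp]

lemma chirp_mul_conj (a τ a' τ' ξ : ℝ) :
    chirp a τ ξ * (starRingEnd ℂ) (chirp a' τ' ξ) = chirp (a - a') (τ - τ') ξ := by
  simp only [chirp, ← Complex.exp_conj, ← Complex.exp_add]
  congr 1
  simp only [map_mul, Complex.conj_I, Complex.conj_ofReal]
  push_cast
  ring

lemma hasDerivAt_chirp (a τ ξ : ℝ) :
    HasDerivAt (chirp a τ) (chirp a τ ξ * (Complex.I * ((a + 2 * τ * ξ : ℝ) : ℂ))) ξ := by
  have h : HasDerivAt (fun ξ : ℝ => a * ξ + τ * ξ ^ 2) (a + 2 * τ * ξ) ξ := by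
    have h1 := ((hasDerivAt_id ξ).const_mul a).add (((hasDerivAt_id ξ).pow 2).const_mul τ)
    convert! h1 using 1
    simp
    ring
  exact (h.ofReal_comp.const_mul Complex.I).cexp

/-- A quadratic phase without stationary points on `[c, d]`. -/
lemma norm_integral_chirp_le_of_ne_zero (a τ : ℝ) {c d : ℝ} (hcd : c ≤ d)
    (h : ∀ ξ ∈ Set.Icc c d, a + 2 * τ * ξ ≠ 0) :
    ‖∫ ξ in c..d, chirp a τ ξ‖ ≤ 2 / |a + 2 * τ * c| + 2 / |a + 2 * τ * d| := by
  have hI : ∀ ξ ∈ Set.uIcc c d, a + 2 * τ * ξ ≠ 0 := by rwa [Set.uIcc_of_le hcd]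
  have hlin : ∀ ξ : ℝ, HasDerivAt (fun ξ : ℝ => a + 2 * τ * ξ) (2 * τ) ξ := fun ξ => by
    simpa using ((hasDerivAt_id ξ).const_mul (2 * τ)).const_add a
  have hinv : ∀ ξ ∈ Set.uIcc c d, HasDerivAt (fun ξ : ℝ => (a + 2 * τ * ξ)⁻¹)
      (-(2 * τ) / (a + 2 * τ * ξ) ^ 2) ξ := fun ξ hξ => (hlin ξ).fun_inv (hI ξ hξ)
  have hcont : ContinuousOn (fun ξ : ℝ => -(2 * τ) / (a + 2 * τ * ξ) ^ 2) (Set.uIcc c d) := by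
    refine ContinuousOn.div (by fun_prop) (by fun_prop) fun ξ hξ => pow_ne_zero _ (hI ξ hξ)
  have hcont' : ContinuousOn (fun ξ : ℝ => chirp a τ ξ *
      (((-(2 * τ) / (a + 2 * τ * ξ) ^ 2 : ℝ) : ℂ) * (-Complex.I))) (Set.uIcc c d) :=
    (continuous_chirp_right a τ).continuousOn.mul
      ((Complex.continuous_ofReal.comp_continuousOn hcont).mul continuousOn_const)
  have hV : ∀ ξ ∈ Set.uIcc c d, HasDerivAt
      (fun ξ : ℝ => chirp a τ ξ * ((((a + 2 * τ * ξ)⁻¹ : ℝ) : ℂ) * (-Complex.I)))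
      (chirp a τ ξ + chirp a τ ξ *
        (((-(2 * τ) / (a + 2 * τ * ξ) ^ 2 : ℝ) : ℂ) * (-Complex.I))) ξ := by
    intro ξ hξ
    have h1 := (hasDerivAt_chirp a τ ξ).mul ((hinv ξ hξ).ofReal_comp.mul_const (-Complex.I))
    convert! h1 using 1
    have h2 : ((a + 2 * τ * ξ : ℝ) : ℂ) ≠ 0 := Complex.ofReal_ne_zero.mpr (hI ξ hξ)
    congr 1
    rw [Complex.ofReal_inv]
    field_simp
    simp
  have hFTC := intervalIntegral.integral_eq_sub_of_hasDerivAt hV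
    (((continuous_chirp_right a τ).continuousOn.add hcont').intervalIntegrable)
  rw [intervalIntegral.integral_add ((continuous_chirp_right a τ).intervalIntegrable _ _)
    hcont'.intervalIntegrable] at hFTC
  have hrem : ‖∫ ξ in c..d, chirp a τ ξ *
      (((-(2 * τ) / (a + 2 * τ * ξ) ^ 2 : ℝ) : ℂ) * (-Complex.I))‖ ≤
      |(a + 2 * τ * d)⁻¹ - (a + 2 * τ * c)⁻¹| := by
    rw [← intervalIntegral.integral_eq_sub_of_hasDerivAt hinv hcont.intervalIntegrable]
    refine (intervalIntegral.norm_integral_le_integral_norm hcd).trans ?_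
    have heq : ∀ ξ, ‖chirp a τ ξ * (((-(2 * τ) / (a + 2 * τ * ξ) ^ 2 : ℝ) : ℂ) * (-Complex.I))‖
        = |(-(2 * τ))| / (a + 2 * τ * ξ) ^ 2 := fun ξ => by
      rw [norm_mul, norm_chirp, norm_mul, Complex.norm_real, norm_neg, Complex.norm_I,
        Real.norm_eq_abs, abs_div, abs_of_nonneg (sq_nonneg (a + 2 * τ * ξ))]
      ring
    simp only [heq]
    simp only [div_eq_mul_inv]
    rw [intervalIntegral.integral_const_mul, intervalIntegral.integral_const_mul, abs_mul]
    gcongr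
    exact le_abs_self _
  have hb : ∀ ξ, ‖chirp a τ ξ * ((((a + 2 * τ * ξ)⁻¹ : ℝ) : ℂ) * (-Complex.I))‖
      = |(a + 2 * τ * ξ)⁻¹| := fun ξ => by
    rw [norm_mul, norm_chirp, norm_mul, Complex.norm_real, norm_neg, Complex.norm_I,
      Real.norm_eq_abs]
    ring
  rw [eq_sub_of_add_eq hFTC]
  refine (norm_sub_le _ _).trans ((add_le_add (norm_sub_le _ _) hrem).trans ?_)
  rw [hb, hb]
  refine (add_le_add_right (abs_sub _ _) _).trans (le_of_eq ?_)
  rw [abs_inv, abs_inv]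
  ring

/-- The truncated integral of `e^{iτξ²}` is at most a multiple of `|τ|^{-1/2}`. -/
lemma norm_integral_chirp_zero_le {τ : ℝ} (hτ : τ ≠ 0) (d : ℝ) :
    ‖∫ ξ in (0 : ℝ)..d, chirp 0 τ ξ‖ ≤ 3 * |τ| ^ (-(1 / 2) : ℝ) := by
  wlog hd : 0 ≤ d generalizing d
  · have h := this (-d) (by linarith)
    have h2 : ∫ ξ in (0 : ℝ)..(-d), chirp 0 τ ξ = -∫ ξ in (0 : ℝ)..d, chirp 0 τ ξ := by
      rw [← intervalIntegral.integral_symm]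
      have := intervalIntegral.integral_comp_neg (a := 0) (b := -d) (chirp 0 τ)
      simp only [chirp_neg_right, neg_zero, neg_neg] at this
      exact this
    rwa [h2, norm_neg] at h
  set δ := |τ| ^ (-(1 / 2) : ℝ) with hδ
  have hτ' : 0 < |τ| := abs_pos.mpr hτ
  have hδ0 : 0 < δ := Real.rpow_pos_of_pos hτ' _
  have hδ2 : |τ| * δ = δ⁻¹ := by
    rw [hδ, ← Real.rpow_neg hτ'.le, ← Real.rpow_one_add' hτ'.le (by norm_num)]
    norm_num
  have htriv : ∀ e, 0 ≤ e → ‖∫ ξ in (0 : ℝ)..e, chirp 0 τ ξ‖ ≤ e := fun e he => by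
    simpa [abs_of_nonneg he] using intervalIntegral.norm_integral_le_of_norm_le_const
      (a := 0) (b := e) (C := 1) fun ξ _ => (norm_chirp 0 τ ξ).le
  rcases le_total d δ with h | h
  · exact (htriv d hd).trans (by linarith)
  rw [← intervalIntegral.integral_add_adjacent_intervals (b := δ)
    ((continuous_chirp_right 0 τ).intervalIntegrable _ _)
    ((continuous_chirp_right 0 τ).intervalIntegrable _ _)]
  refine (norm_add_le _ _).trans ?_
  have h1 := norm_integral_chirp_le_of_ne_zero 0 τ h fun ξ hξ => by
    have : 0 < ξ := hδ0.trans_le hξ.1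
    simp only [zero_add]
    positivity
  have h2 : 2 / |0 + 2 * τ * δ| = δ := by
    rw [zero_add, abs_mul, abs_mul, abs_of_pos hδ0, mul_assoc, hδ2, abs_two]
    field_simp
  have h3 : 2 / |0 + 2 * τ * d| ≤ 2 / |0 + 2 * τ * δ| := by
    simp only [zero_add, abs_mul, abs_of_pos hδ0, abs_of_nonneg hd, abs_two]
    gcongr
  linarith [htriv δ hδ0.le]

/-- Second-order van der Corput estimate for a quadratic phase. -/
lemma norm_integral_chirp_le_rpow (a : ℝ) {τ : ℝ} (hτ : τ ≠ 0) (c d : ℝ) :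
    ‖∫ ξ in c..d, chirp a τ ξ‖ ≤ 6 * |τ| ^ (-(1 / 2) : ℝ) := by
  set b := a / (2 * τ) with hb
  have h : ∀ ξ, chirp a τ ξ = chirp 0 τ (ξ + b) *
      Complex.exp (((-(τ * b ^ 2) : ℝ) : ℂ) * Complex.I) := fun ξ => by
    simp only [chirp, ← Complex.exp_add]
    congr 1
    have : a = 2 * τ * b := by rw [hb]; field_simp
    rw [this]
    push_cast
    ring
  simp only [h]
  rw [intervalIntegral.integral_mul_const, norm_mul, Complex.norm_exp_ofReal_mul_I, mul_one,
    intervalIntegral.integral_comp_add_right (chirp 0 τ),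
    ← intervalIntegral.integral_interval_sub_left (a := 0)
      ((continuous_chirp_right 0 τ).intervalIntegrable _ _)
      ((continuous_chirp_right 0 τ).intervalIntegrable _ _)]
  refine (norm_sub_le _ _).trans ?_
  linarith [norm_integral_chirp_zero_le hτ (d + b), norm_integral_chirp_zero_le hτ (c + b)]

lemma norm_integral_chirp_le_self (a τ : ℝ) {v : ℝ} (hv : 0 ≤ v) :
    ‖∫ ξ in (0 : ℝ)..v, chirp a τ ξ‖ ≤ v := by
  simpa [abs_of_nonneg hv] using intervalIntegral.norm_integral_le_of_norm_le_const
    (a := 0) (b := v) (C := 1) fun ξ _ => (norm_chirp a τ ξ).le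

lemma norm_integral_chirp_le_div {a τ v : ℝ} (hv : 0 ≤ v) (ha : a ≠ 0) (h : 4 * v * |τ| ≤ |a|) :
    ‖∫ ξ in (0 : ℝ)..v, chirp a τ ξ‖ ≤ 8 / |a| := by
  have ha' : 0 < |a| := abs_pos.mpr ha
  have hlow : ∀ ξ ∈ Set.Icc 0 v, |a| / 2 ≤ |a + 2 * τ * ξ| := fun ξ hξ => by
    have h1 : |2 * τ * ξ| ≤ |a| / 2 := by
      rw [abs_mul, abs_mul, abs_two, abs_of_nonneg hξ.1]
      nlinarith [mul_le_mul_of_nonneg_left hξ.2 (abs_nonneg τ)]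
    have h2 := abs_sub_abs_le_abs_sub a (-(2 * τ * ξ))
    rw [abs_neg, sub_neg_eq_add] at h2
    linarith
  refine (norm_integral_chirp_le_of_ne_zero a τ hv fun ξ hξ => ?_).trans ?_
  · exact abs_pos.mp ((half_pos ha').trans_le (hlow ξ hξ))
  · have h0 := hlow 0 ⟨le_rfl, hv⟩
    have h1 := hlow v ⟨hv, le_rfl⟩
    have e : ∀ z, |a| / 2 ≤ z → 2 / z ≤ 4 / |a| := fun z hz => by
      rw [div_le_div_iff₀ (by linarith) ha']
      linarith
    have : 8 / |a| = 4 / |a| + 4 / |a| := by ring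
    rw [this]
    exact add_le_add (e _ h0) (e _ h1)

/-- Interpolation of two bounds on a nonnegative number. -/
lemma le_rpow_mul_rpow_of_le {I v A θ : ℝ} (hI : 0 ≤ I) (h0 : 0 ≤ θ) (h1 : θ ≤ 1)
    (hv : I ≤ v) (hA : I ≤ A) : I ≤ v ^ (1 - θ) * A ^ θ := by
  calc I = I ^ (1 - θ) * I ^ θ := by
        rw [← Real.rpow_add' hI (by norm_num)]
        norm_num
    _ ≤ v ^ (1 - θ) * A ^ θ := by
        have : 0 ≤ 1 - θ := by linarith
        have : 0 ≤ v := hI.trans hv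
        gcongr

lemma rpow_le_one_add_sq_rpow {v e κ : ℝ} (hv : 0 ≤ v) (he : 0 ≤ e) (h : e ≤ κ) :
    v ^ e ≤ (1 + v ^ 2) ^ (κ / 2) := by
  calc v ^ e = (v ^ 2) ^ (e / 2) := by
        rw [← Real.rpow_natCast_mul hv]
        congr 1
        push_cast
        ring
    _ ≤ (1 + v ^ 2) ^ (e / 2) := by gcongr; linarith
    _ ≤ (1 + v ^ 2) ^ (κ / 2) := by
        apply Real.rpow_le_rpow_of_exponent_le
        · nlinarith
        · linarith

/-- The bound for the oscillatory integral over `[0, v]` when the linear coefficient of the phase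
is comparable to `u`. -/
lemma norm_integral_chirp_le_of_le_abs {C₁ u a τ v : ℝ} (hC₁ : 0 < C₁) (hu : 0 < u) (hv : 0 < v)
    (ha : u / (2 * C₁) ≤ |a|) :
    ‖∫ ξ in (0 : ℝ)..v, chirp a τ ξ‖ ≤ (288 * C₁ * v / u) ^ (1 / 2 : ℝ) := by
  have hu' : 0 < u / (2 * C₁) := by positivity
  have ha0 : 0 < |a| := hu'.trans_le ha
  have hI := norm_nonneg (∫ ξ in (0 : ℝ)..v, chirp a τ ξ)
  rw [← Real.sqrt_eq_rpow]
  apply Real.le_sqrt_of_sq_le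
  rcases le_total (4 * v * |τ|) |a| with h | h
  · have h1 := norm_integral_chirp_le_div hv.le (abs_pos.mp ha0) h
    have h2 := norm_integral_chirp_le_self a τ hv.le
    have h3 : 8 / |a| ≤ 16 * C₁ / u := by
      rw [div_le_div_iff₀ ha0 hu]
      rw [div_le_iff₀ (by positivity)] at ha
      nlinarith
    calc _ = ‖∫ ξ in (0 : ℝ)..v, chirp a τ ξ‖ * ‖∫ ξ in (0 : ℝ)..v, chirp a τ ξ‖ := sq _
      _ ≤ v * (16 * C₁ / u) := by gcongr; exact h1.trans h3
      _ = 16 * (C₁ * v / u) := by ring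
      _ ≤ 288 * (C₁ * v / u) := by gcongr; norm_num
      _ = _ := by ring
  · have hτ : 0 < |τ| := by
      by_contra h0
      have : |τ| = 0 := le_antisymm (not_lt.mp h0) (abs_nonneg _)
      rw [this] at h
      linarith
    have h1 := norm_integral_chirp_le_rpow a (abs_pos.mp hτ) 0 v
    have h2 : (|τ| ^ (-(1 / 2) : ℝ)) ^ 2 = |τ|⁻¹ := by
      rw [← Real.rpow_mul_natCast hτ.le, ← Real.rpow_neg_one]
      norm_num
    have h3 : |τ|⁻¹ ≤ 8 * C₁ * v / u := by
      rw [inv_le_comm₀ hτ (by positivity), inv_div, div_le_iff₀ (by positivity)]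
      have := (div_le_iff₀ (by positivity)).mp (ha.trans h)
      nlinarith
    calc _ ≤ (6 * |τ| ^ (-(1 / 2) : ℝ)) ^ 2 := by gcongr
      _ = 36 * |τ|⁻¹ := by rw [mul_pow, h2]; norm_num
      _ ≤ 36 * (8 * C₁ * v / u) := by gcongr
      _ = _ := by ring

/-- The bound for the oscillatory integral when the quadratic coefficient is large compared with
a power of `u`. -/
lemma norm_integral_chirp_le_of_le_rpow {α D u a τ : ℝ} (hα : 0 < α) (hD : 0 < D) (hu : 0 < u)
    (h : u ≤ D * |τ| ^ α) (v : ℝ) :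
    ‖∫ ξ in (0 : ℝ)..v, chirp a τ ξ‖ ≤ 6 * (D / u) ^ (1 / (2 * α)) := by
  have hτ : 0 < |τ| := by
    by_contra h0
    have : |τ| = 0 := le_antisymm (not_lt.mp h0) (abs_nonneg _)
    rw [this, Real.zero_rpow hα.ne'] at h
    linarith
  refine (norm_integral_chirp_le_rpow a (abs_pos.mp hτ) 0 v).trans ?_
  gcongr
  have h1 : (|τ| ^ α)⁻¹ ≤ D / u := by
    rw [inv_le_comm₀ (by positivity) (by positivity), inv_div, div_le_iff₀ hD]
    linarith
  calc |τ| ^ (-(1 / 2) : ℝ) = ((|τ| ^ α)⁻¹) ^ (1 / (2 * α)) := by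
        rw [← Real.rpow_neg hτ.le, ← Real.rpow_mul hτ.le]
        congr 1
        field_simp
    _ ≤ _ := by gcongr

/-- The constant in the bound for oscillatory integrals along tangential curves. -/
def kernelConst (α C₁ C₂ r β : ℝ) : ℝ :=
  (288 * C₁) ^ (min 1 (2 * β) / 2) * (2 * r) ^ (β - min 1 (2 * β) / 2) +
    6 ^ (2 * α * β) * (2 * C₁ * C₂) ^ β

lemma norm_integral_chirp_le_kernelConst {α C₁ C₂ r β κ u a τ v : ℝ} (hα : 0 < α) (hC₁ : 0 < C₁)
    (hC₂ : 0 < C₂) (hβ : 0 < β) (hαβ : 2 * α * β ≤ 1) (hκ₀ : 1 / 2 ≤ κ) (hκ₁ : 1 - β ≤ κ)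
    (hκ₂ : 1 - 2 * α * β ≤ κ) (hu : 0 < u) (hur : u ≤ 2 * r) (hv : 0 ≤ v)
    (h : C₁⁻¹ * u ≤ |a| + C₂ * |τ| ^ α) :
    ‖∫ ξ in (0 : ℝ)..v, chirp a τ ξ‖ ≤
      kernelConst α C₁ C₂ r β * (1 + v ^ 2) ^ (κ / 2) * u ^ (-β) := by
  have hr : 0 < 2 * r := hu.trans_le hur
  have hI := norm_nonneg (∫ ξ in (0 : ℝ)..v, chirp a τ ξ)
  have hIv := norm_integral_chirp_le_self a τ hv
  have hub : 0 < u ^ (-β) := Real.rpow_pos_of_pos hu _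
  have hvp : 0 ≤ (1 + v ^ 2) ^ (κ / 2) := by positivity
  have hA : 0 ≤ (288 * C₁) ^ (min 1 (2 * β) / 2) * (2 * r) ^ (β - min 1 (2 * β) / 2) := by
    positivity
  have hB : 0 ≤ (6 : ℝ) ^ (2 * α * β) * (2 * C₁ * C₂) ^ β := by positivity
  rcases hv.eq_or_lt with rfl | hv'
  · rw [intervalIntegral.integral_same, norm_zero]
    exact mul_nonneg (mul_nonneg (add_nonneg hA hB) hvp) hub.le
  rw [kernelConst, mul_assoc, add_mul]
  rcases le_total (u / (2 * C₁)) |a| with ha | ha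
  · refine le_trans ?_ (le_add_of_nonneg_right (mul_nonneg hB (mul_nonneg hvp hub.le)))
    set θ := min 1 (2 * β) with hθ
    have hθ0 : 0 ≤ θ := le_min zero_le_one (by linarith)
    have hθ1 : θ ≤ 1 := min_le_left _ _
    have hθ2 : θ / 2 ≤ β := by linarith [min_le_right 1 (2 * β)]
    have hθκ : 1 - θ / 2 ≤ κ := by
      rcases min_choice 1 (2 * β) with h' | h' <;> rw [hθ, h'] <;> linarith
    refine (le_rpow_mul_rpow_of_le hI hθ0 hθ1 hIv
      (norm_integral_chirp_le_of_le_abs hC₁ hu hv' ha)).trans ?_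
    have e1 : v ^ (1 - θ) * ((288 * C₁ * v / u) ^ (1 / 2 : ℝ)) ^ θ
        = (288 * C₁) ^ (θ / 2) * v ^ (1 - θ / 2) * u ^ (-(θ / 2)) := by
      rw [← Real.rpow_mul (by positivity), show (1 / 2 : ℝ) * θ = θ / 2 by ring,
        Real.div_rpow (by positivity) hu.le, Real.mul_rpow (by positivity) hv,
        Real.rpow_neg hu.le, show (1 : ℝ) - θ / 2 = (1 - θ) + θ / 2 by ring, Real.rpow_add hv']
      ring
    have e2 : u ^ (-(θ / 2)) ≤ (2 * r) ^ (β - θ / 2) * u ^ (-β) := by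
      rw [show -(θ / 2) = (β - θ / 2) + -β by ring, Real.rpow_add hu]
      have : 0 ≤ β - θ / 2 := by linarith
      gcongr
    rw [e1]
    calc _ ≤ (288 * C₁) ^ (θ / 2) * (1 + v ^ 2) ^ (κ / 2) *
          ((2 * r) ^ (β - θ / 2) * u ^ (-β)) := by
          gcongr
          exact rpow_le_one_add_sq_rpow hv (by linarith) hθκ
      _ = _ := by ring
  · refine le_trans ?_ (le_add_of_nonneg_left (mul_nonneg hA (mul_nonneg hvp hub.le)))
    have h' : u ≤ (2 * C₁ * C₂) * |τ| ^ α := by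
      have e : C₁⁻¹ * u = 2 * (u / (2 * C₁)) := by field_simp
      have : u / (2 * C₁) ≤ C₂ * |τ| ^ α := by linarith
      rw [div_le_iff₀ (by positivity)] at this
      linarith
    refine (le_rpow_mul_rpow_of_le hI (by positivity) hαβ hIv
      (norm_integral_chirp_le_of_le_rpow hα (by positivity) hu h' v)).trans ?_
    rw [Real.mul_rpow (by norm_num) (by positivity), ← Real.rpow_mul (by positivity),
      show 1 / (2 * α) * (2 * α * β) = β by field_simp, Real.div_rpow (by positivity) hu.le]
    calc _ ≤ (1 + v ^ 2) ^ (κ / 2) * (6 ^ (2 * α * β) * ((2 * C₁ * C₂) ^ β / u ^ β)) := by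
          gcongr
          exact rpow_le_one_add_sq_rpow hv (by linarith) hκ₂
      _ = _ := by rw [Real.rpow_neg hu.le]; ring

lemma hasDerivAt_one_add_sq_rpow (e ξ : ℝ) :
    HasDerivAt (fun ξ : ℝ => (1 + ξ ^ 2) ^ e) (2 * e * ξ * (1 + ξ ^ 2) ^ (e - 1)) ξ := by
  have h1 : HasDerivAt (fun ξ : ℝ => 1 + ξ ^ 2) (2 * ξ) ξ := by
    simpa using ((hasDerivAt_id ξ).pow 2).const_add 1
  convert! h1.rpow_const (p := e) (Or.inl (by positivity)) using 1
  ring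

lemma continuous_one_add_sq_rpow (e : ℝ) : Continuous fun ξ : ℝ => (1 + ξ ^ 2) ^ e :=
  continuous_iff_continuousAt.mpr fun ξ => (hasDerivAt_one_add_sq_rpow e ξ).continuousAt

/-- A growth bound for the primitive of `e^{i(aξ+τξ²)}` gives a uniform bound for the integral
with a decaying weight. -/
lemma norm_integral_chirp_mul_weight_le {s κ A a τ R : ℝ} (hκ : 0 ≤ κ) (hs : κ / 2 < s)
    (hA : 0 ≤ A) (hR : 0 ≤ R)
    (h : ∀ v, 0 ≤ v → ‖∫ ξ in (0 : ℝ)..v, chirp a τ ξ‖ ≤ A * (1 + v ^ 2) ^ (κ / 2)) :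
    ‖∫ ξ in (0 : ℝ)..R, chirp a τ ξ * (((1 + ξ ^ 2) ^ (-s) : ℝ) : ℂ)‖ ≤
      A * (1 + s / (s - κ / 2)) := by
  have hs0 : 0 < s := by linarith
  have hsκ : 0 < s - κ / 2 := by linarith
  set J : ℝ → ℂ := fun v => ∫ ξ in (0 : ℝ)..v, chirp a τ ξ with hJ
  have hJd : ∀ v, HasDerivAt J (chirp a τ v) v := fun v =>
    intervalIntegral.integral_hasDerivAt_right ((continuous_chirp_right a τ).intervalIntegrable _ _)
      (continuous_chirp_right a τ).stronglyMeasurable.stronglyMeasurableAtFilter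
      (continuous_chirp_right a τ).continuousAt
  have hJc : Continuous J := continuous_iff_continuousAt.mpr fun v => (hJd v).continuousAt
  set w : ℝ → ℝ := fun ξ => (1 + ξ ^ 2) ^ (-s) with hw
  set w' : ℝ → ℝ := fun ξ => 2 * (-s) * ξ * (1 + ξ ^ 2) ^ (-s - 1) with hw'
  have hwd : ∀ ξ, HasDerivAt w (w' ξ) ξ := hasDerivAt_one_add_sq_rpow (-s)
  have hwc : Continuous w := continuous_one_add_sq_rpow _
  have hwc' : Continuous w' := by
    have := continuous_one_add_sq_rpow (-s - 1)
    fun_prop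
  have hparts := intervalIntegral.integral_eq_sub_of_hasDerivAt
    (a := 0) (b := R) (f := fun ξ => J ξ * (w ξ : ℂ))
    (f' := fun ξ => chirp a τ ξ * (w ξ : ℂ) + J ξ * (w' ξ : ℂ))
    (fun ξ _ => (hJd ξ).mul (hwd ξ).ofReal_comp) (by
      apply Continuous.intervalIntegrable
      fun_prop)
  rw [intervalIntegral.integral_add (by apply Continuous.intervalIntegrable; fun_prop)
    (by apply Continuous.intervalIntegrable; fun_prop)] at hparts
  have hbd : ∀ v : ℝ, 0 ≤ v → (1 + v ^ 2) ^ (κ / 2) * (1 + v ^ 2) ^ (-s) ≤ 1 := fun v _ => by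
    rw [← Real.rpow_add (by positivity)]
    exact Real.rpow_le_one_of_one_le_of_nonpos (by nlinarith [sq_nonneg v]) (by linarith)
  have hrem : ‖∫ ξ in (0 : ℝ)..R, J ξ * (w' ξ : ℂ)‖ ≤ A * (s / (s - κ / 2)) := by
    have hcontb : Continuous fun ξ : ℝ =>
        (A * (s / (s - κ / 2))) * -(2 * (κ / 2 - s) * ξ * (1 + ξ ^ 2) ^ (κ / 2 - s - 1)) := by
      have := continuous_one_add_sq_rpow (κ / 2 - s - 1)
      fun_prop
    have h1 : ‖∫ ξ in (0 : ℝ)..R, J ξ * (w' ξ : ℂ)‖ ≤ ∫ ξ in (0 : ℝ)..R,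
        (A * (s / (s - κ / 2))) * -(2 * (κ / 2 - s) * ξ * (1 + ξ ^ 2) ^ (κ / 2 - s - 1)) := by
      refine intervalIntegral.norm_integral_le_of_norm_le hR (ae_of_all _ fun ξ hξ => ?_)
        (hcontb.intervalIntegrable _ _)
      have hξ0 : 0 ≤ ξ := hξ.1.le
      rw [norm_mul, Complex.norm_real, Real.norm_eq_abs]
      have e1 : |w' ξ| = 2 * s * ξ * (1 + ξ ^ 2) ^ (-s - 1) := by
        rw [hw']
        simp only
        rw [show 2 * -s * ξ * (1 + ξ ^ 2) ^ (-s - 1) = -(2 * s * ξ * (1 + ξ ^ 2) ^ (-s - 1)) by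
          ring, abs_neg, abs_of_nonneg (by positivity)]
      rw [e1]
      calc ‖J ξ‖ * (2 * s * ξ * (1 + ξ ^ 2) ^ (-s - 1))
          ≤ (A * (1 + ξ ^ 2) ^ (κ / 2)) * (2 * s * ξ * (1 + ξ ^ 2) ^ (-s - 1)) := by
            gcongr
            exact h ξ hξ0
        _ = A * 2 * s * ξ * (1 + ξ ^ 2) ^ (κ / 2 - s - 1) := by
            rw [show κ / 2 - s - 1 = κ / 2 + (-s - 1) by ring, Real.rpow_add (by positivity)]
            ring
        _ = _ := by
            rw [show κ / 2 - s = -(s - κ / 2) by ring]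
            generalize s - κ / 2 = ν at hsκ ⊢
            field_simp
    refine h1.trans ?_
    rw [intervalIntegral.integral_const_mul, intervalIntegral.integral_neg]
    rw [intervalIntegral.integral_eq_sub_of_hasDerivAt
      (fun ξ _ => hasDerivAt_one_add_sq_rpow (κ / 2 - s) ξ) (by
        apply Continuous.intervalIntegrable
        have := continuous_one_add_sq_rpow (κ / 2 - s - 1)
        fun_prop)]
    have h2 : 0 ≤ (1 + R ^ 2) ^ (κ / 2 - s) := by positivity
    apply mul_le_of_le_one_right (by positivity)
    norm_num
    exact h2
  have hmain : ‖J R * (w R : ℂ)‖ ≤ A := by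
    rw [norm_mul, Complex.norm_real, Real.norm_of_nonneg (by positivity)]
    calc ‖J R‖ * w R ≤ A * (1 + R ^ 2) ^ (κ / 2) * (1 + R ^ 2) ^ (-s) := by
          gcongr
          exact h R hR
      _ = A * ((1 + R ^ 2) ^ (κ / 2) * (1 + R ^ 2) ^ (-s)) := by ring
      _ ≤ A := mul_le_of_le_one_right hA (hbd R hR)
  rw [eq_sub_of_add_eq hparts]
  have hJ0 : J 0 = 0 := by simp [hJ]
  rw [hJ0, zero_mul, sub_zero, mul_add, mul_one]
  exact (norm_sub_le _ _).trans (add_le_add hmain hrem)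

/-- The kernel of the linearized maximal operator composed with its adjoint. -/
lemma norm_integral_symm_chirp_mul_weight_le {α C₁ C₂ r β κ s u a τ R : ℝ} (hα : 0 < α)
    (hC₁ : 0 < C₁) (hC₂ : 0 < C₂) (hβ : 0 < β) (hαβ : 2 * α * β ≤ 1) (hκ₀ : 1 / 2 ≤ κ)
    (hκ₁ : 1 - β ≤ κ) (hκ₂ : 1 - 2 * α * β ≤ κ) (hs : κ / 2 < s) (hu : 0 < u) (hur : u ≤ 2 * r)
    (hR : 0 ≤ R) (h : C₁⁻¹ * u ≤ |a| + C₂ * |τ| ^ α) :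
    ‖∫ ξ in (-R)..R, chirp a τ ξ * (((1 + ξ ^ 2) ^ (-s) : ℝ) : ℂ)‖ ≤
      2 * kernelConst α C₁ C₂ r β * (1 + s / (s - κ / 2)) * u ^ (-β) := by
  have hr : 0 < 2 * r := hu.trans_le hur
  have hK : 0 ≤ kernelConst α C₁ C₂ r β * u ^ (-β) := by
    unfold kernelConst
    positivity
  have hcont : ∀ a, Continuous fun ξ => chirp a τ ξ * (((1 + ξ ^ 2) ^ (-s) : ℝ) : ℂ) := fun a => by
    have := continuous_one_add_sq_rpow (-s)
    fun_prop
  have key : ∀ a, C₁⁻¹ * u ≤ |a| + C₂ * |τ| ^ α →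
      ‖∫ ξ in (0 : ℝ)..R, chirp a τ ξ * (((1 + ξ ^ 2) ^ (-s) : ℝ) : ℂ)‖ ≤
      kernelConst α C₁ C₂ r β * u ^ (-β) * (1 + s / (s - κ / 2)) := fun a ha =>
    norm_integral_chirp_mul_weight_le (by linarith) hs hK hR fun v hv =>
      (norm_integral_chirp_le_kernelConst hα hC₁ hC₂ hβ hαβ hκ₀ hκ₁ hκ₂ hu hur hv ha).trans
        (le_of_eq (by ring))
  rw [← intervalIntegral.integral_add_adjacent_intervals (b := 0)
    ((hcont a).intervalIntegrable _ _) ((hcont a).intervalIntegrable _ _)]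
  have hrefl : ∫ ξ in (-R)..0, chirp a τ ξ * (((1 + ξ ^ 2) ^ (-s) : ℝ) : ℂ) =
      ∫ ξ in (0 : ℝ)..R, chirp (-a) τ ξ * (((1 + ξ ^ 2) ^ (-s) : ℝ) : ℂ) := by
    have := intervalIntegral.integral_comp_neg (a := 0) (b := R)
      (fun ξ => chirp a τ ξ * (((1 + ξ ^ 2) ^ (-s) : ℝ) : ℂ))
    simp only [chirp_neg_right, neg_zero, neg_sq] at this
    exact this.symm
  rw [hrefl]
  refine (norm_add_le _ _).trans ((add_le_add (key (-a) (by rwa [abs_neg])) (key a h)).trans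
    (le_of_eq (by ring)))

section Duality

variable {X : Type*} [MeasurableSpace X]

/-- A form of Young's inequality: a kernel with bounded `L^m` sections acts on pairs of functions
of the form `Φ^(2m-1)`. -/
lemma lintegral_prod_rpow_mul_kernel_le {μ : Measure X} [SFinite μ] {m : ℝ} (hm : 1 ≤ m)
    {Φ : X → ℝ≥0∞} (hΦ : Measurable Φ) {k : X × X → ℝ≥0∞} (hk : Measurable k) {A : ℝ≥0∞}
    (hA₁ : ∀ᵐ x ∂μ, ∫⁻ y, k (x, y) ^ m ∂μ ≤ A) (hA₂ : ∀ᵐ y ∂μ, ∫⁻ x, k (x, y) ^ m ∂μ ≤ A) :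
    ∫⁻ z, Φ z.1 ^ (2 * m - 1) * Φ z.2 ^ (2 * m - 1) * k z ∂(μ.prod μ) ≤
      (∫⁻ x, Φ x ^ (2 * m) ∂μ) ^ (2 - 1 / m) * A ^ (1 / m) := by
  have hm0 : 0 < m := by linarith
  have ha : 0 ≤ 1 - 1 / m := by
    rw [sub_nonneg, div_le_one hm0]
    exact hm
  have hb : 0 ≤ 1 / (2 * m) := by positivity
  set Q := ∫⁻ x, Φ x ^ (2 * m) ∂μ with hQ
  let f : Fin 3 → X × X → ℝ≥0∞ := ![fun z => Φ z.1 ^ (2 * m) * Φ z.2 ^ (2 * m),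
    fun z => Φ z.1 ^ (2 * m) * k z ^ m, fun z => Φ z.2 ^ (2 * m) * k z ^ m]
  let e : Fin 3 → ℝ := ![1 - 1 / m, 1 / (2 * m), 1 / (2 * m)]
  have hf : ∀ i, Measurable (f i) := by
    intro i
    fin_cases i <;> simp only [f] <;> dsimp <;> fun_prop
  have hsum : ∑ i, e i = 1 := by
    simp only [e, Fin.sum_univ_three, Matrix.cons_val]
    field_simp
    ring
  have hpt : ∀ z, Φ z.1 ^ (2 * m - 1) * Φ z.2 ^ (2 * m - 1) * k z = ∏ i, f i z ^ e i := by
    intro z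
    simp only [f, e, Fin.prod_univ_three, Matrix.cons_val]
    rw [ENNReal.mul_rpow_of_nonneg _ _ ha, ENNReal.mul_rpow_of_nonneg _ _ hb,
      ENNReal.mul_rpow_of_nonneg _ _ hb]
    simp only [← ENNReal.rpow_mul]
    have e1 : 2 * m - 1 = 2 * m * (1 - 1 / m) + 2 * m * (1 / (2 * m)) := by
      field_simp
      ring
    have e2 : k z = k z ^ (m * (1 / (2 * m))) * k z ^ (m * (1 / (2 * m))) := by
      rw [← ENNReal.rpow_add_of_nonneg _ _ (by positivity) (by positivity),
        show m * (1 / (2 * m)) + m * (1 / (2 * m)) = 1 by field_simp; norm_num, ENNReal.rpow_one]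
    rw [e1, ENNReal.rpow_add_of_nonneg _ _ (by positivity) (by positivity),
      ENNReal.rpow_add_of_nonneg _ _ (by positivity) (by positivity)]
    nth_rw 1 [e2]
    ring
  have h0 : ∫⁻ z, f 0 z ∂(μ.prod μ) = Q * Q := by
    simp only [f, Matrix.cons_val]
    exact lintegral_prod_mul (hΦ.pow_const _).aemeasurable (hΦ.pow_const _).aemeasurable
  have h1 : ∫⁻ z, f 1 z ∂(μ.prod μ) ≤ Q * A := by
    rw [lintegral_prod _ (hf 1).aemeasurable]
    simp only [f, Matrix.cons_val]
    rw [hQ, ← lintegral_mul_const _ (by fun_prop)]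
    refine lintegral_mono_ae (hA₁.mono fun x hx => ?_)
    rw [lintegral_const_mul _ (by fun_prop)]
    gcongr
  have h2 : ∫⁻ z, f 2 z ∂(μ.prod μ) ≤ Q * A := by
    rw [lintegral_prod_symm _ (hf 2).aemeasurable]
    simp only [f, Matrix.cons_val]
    rw [hQ, ← lintegral_mul_const _ (by fun_prop)]
    refine lintegral_mono_ae (hA₂.mono fun x hx => ?_)
    rw [lintegral_const_mul _ (by fun_prop)]
    gcongr
  calc ∫⁻ z, Φ z.1 ^ (2 * m - 1) * Φ z.2 ^ (2 * m - 1) * k z ∂(μ.prod μ)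
      = ∫⁻ z, ∏ i, f i z ^ e i ∂(μ.prod μ) := lintegral_congr hpt
    _ ≤ ∏ i, (∫⁻ z, f i z ∂(μ.prod μ)) ^ e i :=
        ENNReal.lintegral_prod_norm_pow_le _ (fun i _ => (hf i).aemeasurable) hsum fun i _ => by
          fin_cases i <;> simp [e] <;> first | simpa using ha | linarith
    _ ≤ (Q * Q) ^ (1 - 1 / m) * (Q * A) ^ (1 / (2 * m)) * (Q * A) ^ (1 / (2 * m)) := by
        rw [Fin.prod_univ_three, h0]
        simp only [e, Matrix.cons_val]
        gcongr
    _ = Q ^ (2 - 1 / m) * A ^ (1 / m) := by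
        have hc : 1 / m = 1 / (2 * m) + 1 / (2 * m) := by field_simp; norm_num
        rw [hc] at ha ⊢
        generalize 1 / (2 * m) = b at ha hb ⊢
        rw [ENNReal.mul_rpow_of_nonneg _ _ ha, ENNReal.mul_rpow_of_nonneg _ _ hb,
          show 2 - (b + b) = ((1 - (b + b)) + (1 - (b + b))) + (b + b) by ring,
          ENNReal.rpow_add_of_nonneg _ _ (add_nonneg ha ha) (add_nonneg hb hb),
          ENNReal.rpow_add_of_nonneg _ _ ha ha, ENNReal.rpow_add_of_nonneg _ _ hb hb,
          ENNReal.rpow_add_of_nonneg _ _ hb hb]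
        ring

variable {μ : Measure X} [IsFiniteMeasure μ] {E : X → ℝ → ℂ} {D : ℝ → ℝ} {G : ℝ → ℂ}
  {k : X × X → ℝ≥0∞} {h : X → ℂ} {M : ℝ}

/-- The squared `L²` norm of `∫ h(x) E(x,·) dμ(x)` is controlled by the kernel
`∫ E(x,ξ) conj(E(y,ξ)) dξ`. -/
lemma lintegral_enorm_sq_adjoint_le (hE : Measurable (Function.uncurry E))
    (hD : MemLp D 2 volume) (hED : ∀ x ξ, ‖E x ξ‖ ≤ D ξ)
    (hk : ∀ᵐ z ∂(μ.prod μ), ‖∫ ξ, E z.1 ξ * (starRingEnd ℂ) (E z.2 ξ)‖ₑ ≤ k z)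
    (hh : Measurable h) (hM : ∀ x, ‖h x‖ ≤ M) :
    ∫⁻ ξ, ‖∫ x, h x * E x ξ ∂μ‖ₑ ^ 2 ≤ ∫⁻ z, ‖h z.1‖ₑ * ‖h z.2‖ₑ * k z ∂(μ.prod μ) := by
  rcases isEmpty_or_nonempty X with hX | ⟨⟨x₁⟩⟩
  · simp [Measure.eq_zero_of_isEmpty]
  have hM0 : 0 ≤ M := (norm_nonneg _).trans (hM x₁)
  have hD0 : ∀ ξ, 0 ≤ D ξ := fun ξ => (norm_nonneg _).trans (hED x₁ ξ)
  set H : ℝ → ℂ := fun ξ => ∫ x, h x * E x ξ ∂μ with hH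
  have hHm : StronglyMeasurable H := by
    apply StronglyMeasurable.integral_prod_right (f := fun ξ x => h x * E x ξ)
    exact ((hh.comp measurable_snd).mul (hE.comp measurable_swap)).stronglyMeasurable
  have hHb : ∀ ξ, ‖H ξ‖ ≤ M * μ.real Set.univ * D ξ := fun ξ => by
    have := norm_integral_le_of_norm_le_const (μ := μ) (f := fun x => h x * E x ξ) (C := M * D ξ)
      (ae_of_all _ fun x => by
        rw [norm_mul]
        exact mul_le_mul (hM x) (hED x ξ) (norm_nonneg _) hM0)
    exact this.trans (le_of_eq (by ring))
  have hHL : MemLp H 2 volume := (hD.const_mul (M * μ.real Set.univ)).mono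
    hHm.aestronglyMeasurable (ae_of_all _ fun ξ => (hHb ξ).trans (le_abs_self _))
  have hsq : ∫⁻ ξ, ‖H ξ‖ₑ ^ 2 = ‖∫ ξ, H ξ * (starRingEnd ℂ) (H ξ)‖ₑ := by
    have e1 : ∀ ξ, H ξ * (starRingEnd ℂ) (H ξ) = ((‖H ξ‖ ^ 2 : ℝ) : ℂ) := fun ξ => by
      rw [Complex.mul_conj, Complex.normSq_eq_norm_sq]
    simp only [e1]
    rw [integral_complex_ofReal, ← ofReal_norm, Complex.norm_real,
      Real.norm_of_nonneg (integral_nonneg fun ξ => by positivity),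
      ofReal_integral_eq_lintegral_ofReal ((memLp_two_iff_integrable_sq_norm
        hHm.aestronglyMeasurable).mp hHL) (ae_of_all _ fun ξ => by positivity)]
    refine lintegral_congr fun ξ => ?_
    rw [ENNReal.ofReal_pow (norm_nonneg _), ofReal_norm]
  rw [hsq]
  have hprod : ∀ ξ, H ξ * (starRingEnd ℂ) (H ξ) =
      ∫ z, (h z.1 * E z.1 ξ) * (starRingEnd ℂ) (h z.2 * E z.2 ξ) ∂(μ.prod μ) := fun ξ => by
    rw [integral_prod_mul (fun x => h x * E x ξ) (fun y => (starRingEnd ℂ) (h y * E y ξ)),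
      integral_conj]
  have hint : Integrable (Function.uncurry fun (ξ : ℝ) (z : X × X) =>
      (h z.1 * E z.1 ξ) * (starRingEnd ℂ) (h z.2 * E z.2 ξ)) (volume.prod (μ.prod μ)) := by
    have hdom : Integrable (fun w : ℝ × X × X => M ^ 2 * D w.1 ^ 2) (volume.prod (μ.prod μ)) :=
      ((memLp_two_iff_integrable_sq hD.1).mp hD |>.const_mul (M ^ 2)).comp_fst (μ.prod μ)
    refine hdom.mono' ?_ (ae_of_all _ fun w => ?_)
    · apply Measurable.aestronglyMeasurable
      have hE1 : Measurable fun w : ℝ × X × X => E w.2.1 w.1 :=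
        hE.comp (measurable_snd.fst.prodMk measurable_fst)
      have hE2 : Measurable fun w : ℝ × X × X => E w.2.2 w.1 :=
        hE.comp (measurable_snd.snd.prodMk measurable_fst)
      exact ((hh.comp measurable_snd.fst).mul hE1).mul
        (Complex.continuous_conj.measurable.comp ((hh.comp measurable_snd.snd).mul hE2))
    · simp only [Function.uncurry, norm_mul, RCLike.norm_conj, sq]
      calc _ ≤ (M * D w.1) * (M * D w.1) := by
            have := hD0 w.1
            gcongr <;> first | exact hM _ | exact hED _ _
        _ = _ := by ring
  simp only [hprod]
  rw [integral_integral_swap hint]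
  refine (enorm_integral_le_lintegral_enorm _).trans (lintegral_mono_ae (hk.mono fun z hz => ?_))
  have e2 : ∀ ξ, (h z.1 * E z.1 ξ) * (starRingEnd ℂ) (h z.2 * E z.2 ξ) =
      (h z.1 * (starRingEnd ℂ) (h z.2)) * (E z.1 ξ * (starRingEnd ℂ) (E z.2 ξ)) := fun ξ => by
    rw [map_mul]
    ring
  simp only [e2]
  rw [integral_const_mul, enorm_mul, enorm_mul]
  have e3 : ‖(starRingEnd ℂ) (h z.2)‖ₑ = ‖h z.2‖ₑ := by
    rw [← ofReal_norm, RCLike.norm_conj, ofReal_norm]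
  rw [e3]
  gcongr

lemma enorm_integral_mul_sq_le (hE : Measurable (Function.uncurry E))
    (hD : MemLp D 2 volume) (hED : ∀ x ξ, ‖E x ξ‖ ≤ D ξ) (hG : MemLp G 2 volume)
    (hk : ∀ᵐ z ∂(μ.prod μ), ‖∫ ξ, E z.1 ξ * (starRingEnd ℂ) (E z.2 ξ)‖ₑ ≤ k z)
    (hh : Measurable h) (hM : ∀ x, ‖h x‖ ≤ M) :
    ‖∫ x, h x * (∫ ξ, E x ξ * G ξ) ∂μ‖ₑ ^ 2 ≤
      (∫⁻ z, ‖h z.1‖ₑ * ‖h z.2‖ₑ * k z ∂(μ.prod μ)) * ∫⁻ ξ, ‖G ξ‖ₑ ^ 2 := by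
  rcases isEmpty_or_nonempty X with hX | ⟨⟨x₁⟩⟩
  · simp [Measure.eq_zero_of_isEmpty]
  have hM0 : 0 ≤ M := (norm_nonneg _).trans (hM x₁)
  have hint : Integrable (Function.uncurry fun (x : X) (ξ : ℝ) => h x * (E x ξ * G ξ))
      (μ.prod volume) := by
    have hdom : Integrable (fun w : X × ℝ => M * (D w.2 * ‖G w.2‖)) (μ.prod volume) :=
      ((hD.integrable_mul hG.norm).const_mul M).comp_snd μ
    refine hdom.mono' ?_ (ae_of_all _ fun w => ?_)
    · exact (hh.comp measurable_fst).aestronglyMeasurable.mul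
        (hE.aestronglyMeasurable.mul hG.1.comp_snd)
    · simp only [Function.uncurry, norm_mul]
      have := (norm_nonneg _).trans (hED w.1 w.2)
      gcongr <;> first | exact hM _ | exact hED _ _
  have hswap : ∫ x, h x * (∫ ξ, E x ξ * G ξ) ∂μ = ∫ ξ, (∫ x, h x * E x ξ ∂μ) * G ξ := by
    simp only [← integral_const_mul, ← integral_mul_const]
    rw [integral_integral_swap hint]
    simp only [mul_assoc]
  have hHm : StronglyMeasurable fun ξ => ∫ x, h x * E x ξ ∂μ := by
    apply StronglyMeasurable.integral_prod_right (f := fun ξ x => h x * E x ξ)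
    exact ((hh.comp measurable_snd).mul (hE.comp measurable_swap)).stronglyMeasurable
  have hCS : ‖∫ x, h x * (∫ ξ, E x ξ * G ξ) ∂μ‖ₑ ≤
      (∫⁻ ξ, ‖∫ x, h x * E x ξ ∂μ‖ₑ ^ (2 : ℝ)) ^ (1 / 2 : ℝ) *
        (∫⁻ ξ, ‖G ξ‖ₑ ^ (2 : ℝ)) ^ (1 / 2 : ℝ) := by
    rw [hswap]
    refine (enorm_integral_le_lintegral_enorm _).trans ?_
    simp only [enorm_mul]
    exact ENNReal.lintegral_mul_le_Lp_mul_Lq volume Real.HolderConjugate.two_two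
      hHm.measurable.enorm.aemeasurable hG.1.enorm
  simp only [ENNReal.rpow_two] at hCS
  calc _ ≤ ((∫⁻ ξ, ‖∫ x, h x * E x ξ ∂μ‖ₑ ^ 2) ^ (1 / 2 : ℝ) *
        (∫⁻ ξ, ‖G ξ‖ₑ ^ 2) ^ (1 / 2 : ℝ)) ^ 2 := by gcongr
    _ = (∫⁻ ξ, ‖∫ x, h x * E x ξ ∂μ‖ₑ ^ 2) * ∫⁻ ξ, ‖G ξ‖ₑ ^ 2 := by
        rw [mul_pow, ← ENNReal.rpow_mul_natCast, ← ENNReal.rpow_mul_natCast]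
        norm_num
    _ ≤ _ := by
        gcongr
        exact lintegral_enorm_sq_adjoint_le hE hD hED hk hh hM

/-- An operator `G ↦ ∫ E(x,ξ) G(ξ) dξ` maps `L²` to `L^{2m}` if the kernel of its composition
with the adjoint has bounded `L^m` sections. -/
theorem lintegral_enorm_rpow_le_of_kernel {m : ℝ} (hm : 1 ≤ m)
    (hE : Measurable (Function.uncurry E))
    (hD : MemLp D 2 volume) (hED : ∀ x ξ, ‖E x ξ‖ ≤ D ξ) (hG : MemLp G 2 volume)
    (hkm : Measurable k)
    (hk : ∀ᵐ z ∂(μ.prod μ), ‖∫ ξ, E z.1 ξ * (starRingEnd ℂ) (E z.2 ξ)‖ₑ ≤ k z) {A : ℝ≥0∞}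
    (hA₁ : ∀ᵐ x ∂μ, ∫⁻ y, k (x, y) ^ m ∂μ ≤ A) (hA₂ : ∀ᵐ y ∂μ, ∫⁻ x, k (x, y) ^ m ∂μ ≤ A) :
    ∫⁻ x, ‖∫ ξ, E x ξ * G ξ‖ₑ ^ (2 * m) ∂μ ≤ A * (∫⁻ ξ, ‖G ξ‖ₑ ^ 2) ^ m := by
  wlog hGm : StronglyMeasurable G generalizing G
  · obtain ⟨G', hG', hGG'⟩ := hG.1
    have h1 := this (hG.ae_eq hGG') hG'
    have h2 : ∀ x, ∫ ξ, E x ξ * G ξ = ∫ ξ, E x ξ * G' ξ := fun x =>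
      integral_congr_ae (hGG'.mono fun ξ hξ => by simp only [hξ])
    have h3 : ∫⁻ ξ, ‖G ξ‖ₑ ^ 2 = ∫⁻ ξ, ‖G' ξ‖ₑ ^ 2 :=
      lintegral_congr_ae (hGG'.mono fun ξ hξ => by simp only [hξ])
    simpa only [h2, h3] using h1
  have hm0 : 0 < m := by linarith
  set F : X → ℂ := fun x => ∫ ξ, E x ξ * G ξ with hF
  have hFm : Measurable F := by
    apply StronglyMeasurable.measurable
    apply StronglyMeasurable.integral_prod_right (f := fun x ξ => E x ξ * G ξ)
    exact (hE.mul (hGm.measurable.comp measurable_snd)).stronglyMeasurable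
  set M := ∫ ξ, D ξ * ‖G ξ‖ with hMdef
  have hFb : ∀ x, ‖F x‖ ≤ M := fun x => by
    refine norm_integral_le_of_norm_le (hD.integrable_mul hG.norm) (ae_of_all _ fun ξ => ?_)
    rw [norm_mul]
    exact mul_le_mul_of_nonneg_right (hED x ξ) (norm_nonneg _)
  set h : X → ℂ := fun x => (starRingEnd ℂ) (F x) * ((‖F x‖ ^ (2 * m - 2) : ℝ) : ℂ) with hh
  have hhm : Measurable h := by
    have : Measurable fun x => (starRingEnd ℂ) (F x) :=
      Complex.continuous_conj.measurable.comp hFm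
    have : Measurable fun x => ((‖F x‖ ^ (2 * m - 2) : ℝ) : ℂ) := by fun_prop
    exact Measurable.mul ‹_› ‹_›
  have hhn : ∀ x, ‖h x‖ = ‖F x‖ ^ (2 * m - 1) := fun x => by
    rw [hh]
    simp only [norm_mul, RCLike.norm_conj, Complex.norm_real]
    rw [Real.norm_of_nonneg (by positivity), ← Real.rpow_one_add' (norm_nonneg _) (by linarith)]
    congr 1
    ring
  have hhb : ∀ x, ‖h x‖ ≤ M ^ (2 * m - 1) := fun x => by
    rw [hhn]
    have := hFb x
    have : 0 ≤ 2 * m - 1 := by linarith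
    gcongr
  have hhe : ∀ x, ‖h x‖ₑ = ‖F x‖ₑ ^ (2 * m - 1) := fun x => by
    rw [← ofReal_norm, hhn, ← ENNReal.ofReal_rpow_of_nonneg (norm_nonneg _) (by linarith),
      ofReal_norm]
  have hhF : ∀ x, h x * F x = ((‖F x‖ ^ (2 * m) : ℝ) : ℂ) := fun x => by
    have : h x * F x = F x * (starRingEnd ℂ) (F x) * ((‖F x‖ ^ (2 * m - 2) : ℝ) : ℂ) := by
      rw [hh]
      ring
    rw [this, Complex.mul_conj, Complex.normSq_eq_norm_sq, ← Complex.ofReal_mul,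
      ← Real.rpow_natCast, ← Real.rpow_add' (norm_nonneg _) (by push_cast; linarith)]
    congr 2
    push_cast
    ring
  set Q := ∫⁻ x, ‖F x‖ₑ ^ (2 * m) ∂μ with hQ
  have hFpb : ∀ x, ‖F x‖ ^ (2 * m) ≤ M ^ (2 * m) := fun x => by
    have := hFb x
    gcongr
  have hFint : Integrable (fun x => ‖F x‖ ^ (2 * m)) μ :=
    Integrable.of_bound (hFm.norm.pow_const _).aestronglyMeasurable (M ^ (2 * m)) (ae_of_all _ fun x => by
      rw [Real.norm_of_nonneg (by positivity)]
      exact hFpb x)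
  have hFe : ∀ x, ENNReal.ofReal (‖F x‖ ^ (2 * m)) = ‖F x‖ₑ ^ (2 * m) := fun x => by
    rw [← ENNReal.ofReal_rpow_of_nonneg (norm_nonneg _) (by linarith), ofReal_norm]
  have hQeq : Q = ENNReal.ofReal (∫ x, ‖F x‖ ^ (2 * m) ∂μ) := by
    rw [ofReal_integral_eq_lintegral_ofReal hFint (ae_of_all _ fun x => by positivity)]
    simp only [hFe, hQ]
  have hQtop : Q ≠ ∞ := hQeq ▸ ENNReal.ofReal_ne_top
  have hQh : ‖∫ x, h x * (∫ ξ, E x ξ * G ξ) ∂μ‖ₑ = Q := by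
    have : ∀ x, h x * ∫ ξ, E x ξ * G ξ = ((‖F x‖ ^ (2 * m) : ℝ) : ℂ) := hhF
    simp only [this]
    rw [integral_complex_ofReal, ← ofReal_norm, Complex.norm_real,
      Real.norm_of_nonneg (integral_nonneg fun x => by positivity), hQeq]
  have key := enorm_integral_mul_sq_le hE hD hED hG hk hhm hhb
  simp only [hhe] at key
  rw [hQh] at key
  have hY := lintegral_prod_rpow_mul_kernel_le hm hFm.enorm hkm hA₁ hA₂
  rcases eq_or_ne Q 0 with h0 | h0
  · rw [h0]
    exact zero_le
  have hfin : Q ^ (1 / m) ≤ A ^ (1 / m) * ∫⁻ ξ, ‖G ξ‖ₑ ^ 2 := by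
    have h1 : Q ^ (2 - 1 / m) * Q ^ (1 / m) ≤
        Q ^ (2 - 1 / m) * (A ^ (1 / m) * ∫⁻ ξ, ‖G ξ‖ₑ ^ 2) := by
      rw [← ENNReal.rpow_add _ _ h0 hQtop, ← mul_assoc]
      have : Q ^ (2 - 1 / m + 1 / m) = Q ^ 2 := by
        rw [sub_add_cancel, ENNReal.rpow_two]
      rw [this]
      exact key.trans (by gcongr)
    exact (ENNReal.mul_le_mul_iff_right (ENNReal.rpow_pos (pos_iff_ne_zero.mpr h0) hQtop).ne'
      (ENNReal.rpow_ne_top_of_ne_zero h0 hQtop)).mp h1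
  calc Q = (Q ^ (1 / m)) ^ m := by
        rw [← ENNReal.rpow_mul, one_div_mul_cancel hm0.ne', ENNReal.rpow_one]
    _ ≤ (A ^ (1 / m) * ∫⁻ ξ, ‖G ξ‖ₑ ^ 2) ^ m := by gcongr
    _ = _ := by
        rw [ENNReal.mul_rpow_of_nonneg _ _ hm0.le, ← ENNReal.rpow_mul,
          one_div_mul_cancel hm0.ne', ENNReal.rpow_one]

end Duality

lemma lintegral_ball_enorm_rpow_neg_lt_top {e ρ : ℝ} (he : e < 1) (hρ : 0 ≤ ρ) :
    ∫⁻ u in Metric.ball (0 : ℝ) ρ, ‖u‖ₑ ^ (-e) < ∞ := by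
  have h1 : IntervalIntegrable (fun u : ℝ => |u| ^ (-e)) volume 0 ρ := by
    refine (intervalIntegral.intervalIntegrable_rpow' (r := -e) (by linarith)).congr ?_
    intro u hu
    rw [Set.uIoc_of_le hρ] at hu
    simp only [abs_of_pos hu.1]
  have h2 : IntervalIntegrable (fun u : ℝ => |u| ^ (-e)) volume (-ρ) 0 := by
    have := (IntervalIntegrable.iff_comp_neg (f := fun u : ℝ => |u| ^ (-e)) (a := 0) (b := ρ)).mp h1
    simp only [abs_neg, neg_zero] at this
    exact this.symm
  have h3 : IntegrableOn (fun u : ℝ => |u| ^ (-e)) (Metric.ball 0 ρ) := by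
    have h := (intervalIntegrable_iff_integrableOn_Ioc_of_le (by linarith)).mp (h2.trans h1)
    refine h.mono_set ?_
    rw [Real.ball_eq_Ioo]
    intro u hu
    exact ⟨by linarith [hu.1], by linarith [hu.2]⟩
  have h4 := h3.2
  rw [hasFiniteIntegral_iff_enorm] at h4
  refine lt_of_eq_of_lt (lintegral_congr_ae (ae_restrict_of_ae ?_)) h4
  have h0 : ∀ᵐ u : ℝ, u ≠ 0 := by simp [ae_iff]
  filter_upwards [h0] with u hu
  have hu' : 0 < |u| := abs_pos.mpr hu
  rw [← ofReal_norm, ← ofReal_norm, Real.norm_eq_abs, Real.norm_of_nonneg (by positivity),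
    ENNReal.ofReal_rpow_of_pos hu']

/-- Finitely many measurable functions have a measurable choice of an index with maximal value. -/
lemma exists_measurable_argmax {X : Type*} [MeasurableSpace X] {F : ℕ → X → ℝ≥0∞}
    (hF : ∀ n, Measurable (F n)) (n : ℕ) :
    ∃ ι : X → ℕ, Measurable ι ∧ (∀ x, ι x ≤ n) ∧ ∀ x, ∀ j ≤ n, F j x ≤ F (ι x) x := by
  induction n with
  | zero => exact ⟨fun _ => 0, measurable_const, fun _ => le_rfl, fun x j hj => by
      rw [Nat.le_zero.mp hj]⟩
  | succ n ih =>
    obtain ⟨ι, hι, hle, hmax⟩ := ih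
    have hFι : Measurable fun x => F (ι x) x :=
      (measurable_from_prod_countable_right (f := fun q : ℕ × X => F q.1 q.2) hF).comp
        (hι.prodMk measurable_id)
    classical
    refine ⟨fun x => if F (ι x) x ≤ F (n + 1) x then n + 1 else ι x,
      Measurable.ite (measurableSet_le hFι (hF _)) measurable_const hι, fun x => ?_,
      fun x j hj => ?_⟩
    · dsimp only
      split_ifs
      · exact le_rfl
      · exact (hle x).trans (Nat.le_succ n)
    · dsimp only
      rcases Nat.le_succ_iff.mp hj with hj | hj
      · split_ifs with h
        · exact (hmax x j hj).trans h
        · exact hmax x j hj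
      · subst hj
        split_ifs with h
        · exact le_rfl
        · exact (not_le.mp h).le

/-- The truncated integral `∫_{-R}^{R} e^{i(aξ + tξ²)} g(ξ) dξ`. -/
def truncIntegral (g : ℝ → ℂ) (a t R : ℝ) : ℂ := ∫ ξ in (-R)..R, chirp a t ξ * g ξ

lemma continuous_truncIntegral {g : ℝ → ℂ} (hg : LocallyIntegrable g volume) :
    Continuous fun q : (ℝ × ℝ) × ℝ => truncIntegral g q.1.1 q.1.2 q.2 := by
  have hint : ∀ c d, IntervalIntegrable g volume c d := fun c d =>
    (hg.integrableOn_isCompact isCompact_uIcc).intervalIntegrable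
  have hchirp : ∀ q : ℝ × ℝ, ∀ c d, IntervalIntegrable (fun ξ => chirp q.1 q.2 ξ * g ξ) volume c d :=
    fun q c d => (hint c d).continuousOn_mul (continuous_chirp_right q.1 q.2).continuousOn
  have hprim : Continuous fun q : (ℝ × ℝ) × ℝ => ∫ ξ in (0 : ℝ)..q.2, chirp q.1.1 q.1.2 ξ * g ξ := by
    rw [continuous_iff_continuousAt]
    rintro ⟨x, b⟩
    have hb := abs_nonneg b
    refine intervalIntegral.continuousAt_parametric_primitive_of_dominated
      (F := fun (x : ℝ × ℝ) ξ => chirp x.1 x.2 ξ * g ξ) (fun ξ => ‖g ξ‖) (-(|b| + 1)) (|b| + 1)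
      (fun q => (hchirp q _ _).def'.aestronglyMeasurable) (Eventually.of_forall fun q =>
        ae_of_all _ fun ξ => by rw [norm_mul, norm_chirp, one_mul]) (hint _ _).norm
      (ae_of_all _ fun ξ => ?_) ⟨by linarith, by linarith⟩
      ⟨by linarith [neg_abs_le b], by linarith [le_abs_self b]⟩ (measure_singleton b)
    have : Continuous fun q : ℝ × ℝ => chirp q.1 q.2 ξ * g ξ :=
      (continuous_chirp.comp (continuous_fst.prodMk
        (continuous_snd.prodMk continuous_const))).mul continuous_const
    exact this.continuousAt
  have heq : (fun q : (ℝ × ℝ) × ℝ => truncIntegral g q.1.1 q.1.2 q.2) = fun q =>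
      (∫ ξ in (0 : ℝ)..q.2, chirp q.1.1 q.1.2 ξ * g ξ) -
        ∫ ξ in (0 : ℝ)..(-q.2), chirp q.1.1 q.1.2 ξ * g ξ := by
    funext q
    rw [truncIntegral, intervalIntegral.integral_interval_sub_left (hchirp _ _ _) (hchirp _ _ _)]
  rw [heq]
  exact hprim.sub (hprim.comp (continuous_fst.prodMk continuous_snd.neg))

namespace IsTangentialCurve

variable {α C₁ C₂ x₀ r : ℝ} {γ : ℝ → ℝ → ℝ}

lemma continuousOn_left (hγ : IsTangentialCurve α C₁ C₂ x₀ r γ) (hC₁ : 0 ≤ C₁) {t : ℝ}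
    (ht : t ∈ Set.Icc (0 : ℝ) 1) : ContinuousOn (fun x => γ x t) (Metric.ball x₀ r) :=
  (LipschitzOnWith.of_dist_le_mul (K := ⟨C₁, hC₁⟩) fun x hx y hy => by
    rw [Real.dist_eq, Real.dist_eq]
    exact hγ.upper x hx y hy t ht).continuousOn

lemma continuousOn_right (hγ : IsTangentialCurve α C₁ C₂ x₀ r γ) (hα : 0 < α) {x : ℝ}
    (hx : x ∈ Metric.ball x₀ r) : ContinuousOn (γ x) (Set.Icc 0 1) := by
  intro t ht
  rw [ContinuousWithinAt, tendsto_iff_dist_tendsto_zero]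
  have hlim : Tendsto (fun t' : ℝ => C₂ * |t' - t| ^ α) (𝓝[Set.Icc 0 1] t) (𝓝 0) := by
    have hc : Continuous fun t' : ℝ => C₂ * |t' - t| ^ α := by
      exact continuous_const.mul
        ((continuous_abs.comp (continuous_id.sub continuous_const)).rpow_const fun _ =>
          Or.inr hα.le)
    have := (hc.tendsto t).mono_left (nhdsWithin_le_nhds (s := Set.Icc 0 1))
    simpa [Real.zero_rpow hα.ne'] using this
  refine squeeze_zero' (Eventually.of_forall fun _ => dist_nonneg) ?_ hlim
  filter_upwards [self_mem_nhdsWithin] with t' ht'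
  rw [Real.dist_eq]
  exact hγ.holder x hx t' ht' t ht

/-- Points of the curves through `x` and `y` can only be close if the times differ. -/
lemma separation (hγ : IsTangentialCurve α C₁ C₂ x₀ r γ) {x y t t' : ℝ}
    (hx : x ∈ Metric.ball x₀ r) (hy : y ∈ Metric.ball x₀ r) (ht : t ∈ Set.Icc (0 : ℝ) 1)
    (ht' : t' ∈ Set.Icc (0 : ℝ) 1) :
    C₁⁻¹ * |x - y| ≤ |γ x t - γ y t'| + C₂ * |t - t'| ^ α := by
  have h1 := hγ.lower x hx y hy t ht
  have h2 := hγ.holder y hy t' ht' t ht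
  rw [abs_sub_comm t' t] at h2
  have h3 := abs_sub_le (γ x t) (γ y t') (γ y t)
  linarith

end IsTangentialCurve

/-- The function `(1 + ξ²)^{s/2} g(ξ)`. -/
def sobolevWeight (s : ℝ) (g : ℝ → ℂ) (ξ : ℝ) : ℂ := (((1 + ξ ^ 2) ^ (s / 2) : ℝ) : ℂ) * g ξ

lemma weight_inv_mul_sobolevWeight (s : ℝ) (g : ℝ → ℂ) (ξ : ℝ) :
    (((1 + ξ ^ 2) ^ (-(s / 2)) : ℝ) : ℂ) * sobolevWeight s g ξ = g ξ := by
  rw [sobolevWeight, ← mul_assoc, ← Complex.ofReal_mul, ← Real.rpow_add (by positivity)]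
  simp

lemma one_add_sq_rpow_neg_le_one {e : ℝ} (he : 0 ≤ e) (ξ : ℝ) : (1 + ξ ^ 2) ^ (-e) ≤ 1 :=
  Real.rpow_le_one_of_one_le_of_nonpos (by nlinarith [sq_nonneg ξ]) (by linarith)

lemma memLp_of_memLp_sobolevWeight {s : ℝ} (hs : 0 ≤ s) {g : ℝ → ℂ}
    (hg : MemLp (sobolevWeight s g) 2 volume) : MemLp g 2 volume := by
  have heq : g = fun ξ => (((1 + ξ ^ 2) ^ (-(s / 2)) : ℝ) : ℂ) * sobolevWeight s g ξ :=
    funext fun ξ => (weight_inv_mul_sobolevWeight s g ξ).symm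
  have hc : Continuous fun ξ : ℝ => (((1 + ξ ^ 2) ^ (-(s / 2)) : ℝ) : ℂ) :=
    Complex.continuous_ofReal.comp (continuous_one_add_sq_rpow _)
  refine hg.mono (by rw [heq]; exact hc.aestronglyMeasurable.mul hg.1) (ae_of_all _ fun ξ => ?_)
  nth_rw 1 [heq]
  rw [norm_mul, Complex.norm_real, Real.norm_of_nonneg (by positivity)]
  exact mul_le_of_le_one_left (norm_nonneg _) (one_add_sq_rpow_neg_le_one (by linarith) ξ)

/-- The constant in the maximal estimate. -/
def maximalConst (α C₁ C₂ r β κ s m : ℝ) : ℝ≥0∞ :=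
  ENNReal.ofReal (2 * kernelConst α C₁ C₂ r β * (1 + s / (s - κ / 2))) ^ m *
    ∫⁻ u in Metric.ball (0 : ℝ) (2 * r), ‖u‖ₑ ^ (-(β * m))

/-- Admissible exponents in the kernel estimate. -/
structure AdmissibleExponents (α β κ s m : ℝ) : Prop where
  one_le : 1 ≤ m
  beta_pos : 0 < β
  beta_mul_lt : β * m < 1
  two_mul_le : 2 * α * β ≤ 1
  half_le : 1 / 2 ≤ κ
  one_sub_le : 1 - β ≤ κ
  one_sub_two_mul_le : 1 - 2 * α * β ≤ κ
  kappa_lt : κ / 2 < s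

lemma maximalConst_ne_top {α β κ s m : ℝ} (C₁ C₂ : ℝ) {r : ℝ} (hr : 0 < r)
    (h : AdmissibleExponents α β κ s m) : maximalConst α C₁ C₂ r β κ s m ≠ ∞ :=
  ENNReal.mul_ne_top (ENNReal.rpow_ne_top_of_nonneg (by linarith [h.one_le]) ENNReal.ofReal_ne_top)
    (lintegral_ball_enorm_rpow_neg_lt_top h.beta_mul_lt (by linarith)).ne

section

variable {α C₁ C₂ x₀ r β κ s m : ℝ} {γ : ℝ → ℝ → ℝ}

/-- The maximal estimate with measurably chosen times and truncations. -/
theorem lintegral_truncIntegral_linearized_le (hα : 0 < α) (hC₁ : 0 < C₁) (hC₂ : 0 < C₂)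
    (hexp : AdmissibleExponents α β κ s m) (hγ : IsTangentialCurve α C₁ C₂ x₀ r γ)
    {a τ ρ : ℝ → ℝ} (ha : Measurable a) (hτ : Measurable τ) (hρ : Measurable ρ)
    (haγ : ∀ x ∈ Metric.ball x₀ r, a x = γ x (τ x)) (hτ01 : ∀ x, τ x ∈ Set.Icc (0 : ℝ) 1)
    (hρ0 : ∀ x, 0 ≤ ρ x) {P : ℝ} (hρP : ∀ x, ρ x ≤ P) {g : ℝ → ℂ}
    (hg : MemLp (sobolevWeight s g) 2 volume) :
    ∫⁻ x in Metric.ball x₀ r, ‖truncIntegral g (a x) (τ x) (ρ x)‖ₑ ^ (2 * m) ≤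
      maximalConst α C₁ C₂ r β κ s m * (∫⁻ ξ, ‖sobolevWeight s g ξ‖ₑ ^ 2) ^ m := by
  obtain ⟨hm, hβ, hβm, hαβ, hκ₀, hκ₁, hκ₂, hs⟩ := hexp
  have hs0 : 0 < s := by linarith
  set w : ℝ → ℂ := fun ξ => (((1 + ξ ^ 2) ^ (-(s / 2)) : ℝ) : ℂ) with hw
  have hwc : Continuous w := Complex.continuous_ofReal.comp (continuous_one_add_sq_rpow _)
  set E : ℝ → ℝ → ℂ := fun x ξ =>
    (Set.Ioc (-ρ x) (ρ x)).indicator (fun ξ => chirp (a x) (τ x) ξ * w ξ) ξ with hE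
  have hEm : Measurable (Function.uncurry E) := by
    have hset : MeasurableSet {q : ℝ × ℝ | q.2 ∈ Set.Ioc (-ρ q.1) (ρ q.1)} :=
      (measurableSet_lt (hρ.comp measurable_fst).neg measurable_snd).inter
        (measurableSet_le measurable_snd (hρ.comp measurable_fst))
    have hfun : Measurable fun q : ℝ × ℝ => chirp (a q.1) (τ q.1) q.2 * w q.2 :=
      (continuous_chirp.measurable.comp ((ha.comp measurable_fst).prodMk
        ((hτ.comp measurable_fst).prodMk measurable_snd))).mul
        (hwc.measurable.comp measurable_snd)
    exact hfun.indicator hset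
  set D : ℝ → ℝ := (Set.Icc (-P) P).indicator fun _ => 1 with hD
  have hDL : MemLp D 2 volume :=
    memLp_indicator_const 2 measurableSet_Icc 1 (Or.inr measure_Icc_lt_top.ne)
  have hED : ∀ x ξ, ‖E x ξ‖ ≤ D ξ := fun x ξ => by
    by_cases hξ : ξ ∈ Set.Ioc (-ρ x) (ρ x)
    · have : ξ ∈ Set.Icc (-P) P := ⟨by linarith [hξ.1, hρP x], hξ.2.trans (hρP x)⟩
      rw [hE, hD]
      simp only [Set.indicator_of_mem hξ, Set.indicator_of_mem this]
      rw [norm_mul, norm_chirp, one_mul, hw, Complex.norm_real,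
        Real.norm_of_nonneg (by positivity)]
      exact one_add_sq_rpow_neg_le_one (by linarith) ξ
    · rw [hE]
      simp only [Set.indicator_of_notMem hξ, norm_zero]
      exact Set.indicator_nonneg (fun _ _ => zero_le_one) _
  set K := ENNReal.ofReal (2 * kernelConst α C₁ C₂ r β * (1 + s / (s - κ / 2))) with hK
  set k : ℝ × ℝ → ℝ≥0∞ := fun z => K * ‖z.1 - z.2‖ₑ ^ (-β) with hk
  have hkm : Measurable k := by
    apply Measurable.const_mul
    exact (measurable_fst.sub measurable_snd).enorm.pow_const _
  have hEE : ∀ x y, ∫ ξ, E x ξ * (starRingEnd ℂ) (E y ξ) =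
      ∫ ξ in (-min (ρ x) (ρ y))..(min (ρ x) (ρ y)),
        chirp (a x - a y) (τ x - τ y) ξ * (((1 + ξ ^ 2) ^ (-s) : ℝ) : ℂ) := fun x y => by
    have h0 : 0 ≤ min (ρ x) (ρ y) := le_min (hρ0 x) (hρ0 y)
    rw [intervalIntegral.integral_of_le (by linarith), ← integral_indicator measurableSet_Ioc]
    congr 1
    funext ξ
    have hset : Set.Ioc (-ρ x) (ρ x) ∩ Set.Ioc (-ρ y) (ρ y) =
        Set.Ioc (-min (ρ x) (ρ y)) (min (ρ x) (ρ y)) := by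
      rw [Set.Ioc_inter_Ioc]
      congr 1
      exact max_neg_neg _ _
    rw [← hset]
    by_cases hx : ξ ∈ Set.Ioc (-ρ x) (ρ x)
    · by_cases hy : ξ ∈ Set.Ioc (-ρ y) (ρ y)
      · rw [Set.indicator_of_mem (Set.mem_inter hx hy)]
        simp only [hE, Set.indicator_of_mem hx, Set.indicator_of_mem hy]
        rw [← chirp_mul_conj, map_mul]
        have hww : w ξ * (starRingEnd ℂ) (w ξ) = (((1 + ξ ^ 2) ^ (-s) : ℝ) : ℂ) := by
          simp only [hw, Complex.conj_ofReal]
          rw [← Complex.ofReal_mul, ← Real.rpow_add (by positivity)]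
          congr 2
          ring
        rw [← hww]
        ring
      · rw [Set.indicator_of_notMem fun h => hy h.2]
        simp only [hE, Set.indicator_of_notMem hy, map_zero, mul_zero]
    · rw [Set.indicator_of_notMem fun h => hx h.1]
      simp only [hE, Set.indicator_of_notMem hx, zero_mul]
  set μ := (volume : Measure ℝ).restrict (Metric.ball x₀ r) with hμ
  have : IsFiniteMeasure μ := ⟨by
    rw [hμ, Measure.restrict_apply_univ]
    exact measure_ball_lt_top⟩
  have hkb : ∀ᵐ z ∂(μ.prod μ), ‖∫ ξ, E z.1 ξ * (starRingEnd ℂ) (E z.2 ξ)‖ₑ ≤ k z := by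
    rw [hμ, Measure.prod_restrict]
    refine ae_restrict_of_forall_mem (Metric.isOpen_ball.measurableSet.prod
      Metric.isOpen_ball.measurableSet) ?_
    rintro ⟨x, y⟩ ⟨hx, hy⟩
    simp only at hx hy ⊢
    have hd : |x - y| ≤ 2 * r := by
      rw [Metric.mem_ball, Real.dist_eq] at hx hy
      rw [abs_sub_comm] at hy
      linarith [abs_sub_le x x₀ y]
    have hr : 0 < r := Metric.pos_of_mem_ball hx
    have hKpos : 0 < 2 * kernelConst α C₁ C₂ r β * (1 + s / (s - κ / 2)) := by
      have : 0 < s - κ / 2 := by linarith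
      unfold kernelConst
      positivity
    rcases eq_or_ne x y with rfl | hxy
    · have : k (x, x) = ∞ := by
        simp only [hk, sub_self, enorm_zero]
        rw [ENNReal.zero_rpow_of_neg (by linarith), ENNReal.mul_top]
        exact (ENNReal.ofReal_pos.mpr hKpos).ne'
      rw [this]
      exact le_top
    have hu : 0 < |x - y| := abs_pos.mpr (sub_ne_zero.mpr hxy)
    have hsep := hγ.separation hx hy (hτ01 x) (hτ01 y)
    rw [← haγ x hx, ← haγ y hy] at hsep
    rw [hEE x y]
    have hb := norm_integral_symm_chirp_mul_weight_le (r := r) hα hC₁ hC₂ hβ hαβ hκ₀ hκ₁ hκ₂ hs hu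
      hd (le_min (hρ0 x) (hρ0 y)) hsep
    rw [← ofReal_norm]
    refine (ENNReal.ofReal_le_ofReal hb).trans (le_of_eq ?_)
    rw [ENNReal.ofReal_mul hKpos.le, ← ENNReal.ofReal_rpow_of_pos hu, ← Real.norm_eq_abs,
      ofReal_norm]
  have hAx : ∀ᵐ x ∂μ, ∫⁻ y, k (x, y) ^ m ∂μ ≤ maximalConst α C₁ C₂ r β κ s m := by
    refine ae_restrict_of_forall_mem Metric.isOpen_ball.measurableSet fun x hx => ?_
    have h1 : ∀ y, k (x, y) ^ m = K ^ m * ‖x - y‖ₑ ^ (-(β * m)) := fun y => by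
      simp only [hk]
      rw [ENNReal.mul_rpow_of_nonneg _ _ (by linarith), ← ENNReal.rpow_mul, neg_mul]
    simp only [h1]
    rw [lintegral_const_mul _ (by fun_prop), maximalConst]
    refine mul_le_mul' le_rfl ?_
    rw [← lintegral_indicator Metric.isOpen_ball.measurableSet,
      ← lintegral_indicator Metric.isOpen_ball.measurableSet,
      ← lintegral_sub_left_eq_self
        ((Metric.ball (0 : ℝ) (2 * r)).indicator fun u => ‖u‖ₑ ^ (-(β * m))) x]
    refine lintegral_mono fun y => ?_
    by_cases hy : y ∈ Metric.ball x₀ r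
    · have : x - y ∈ Metric.ball (0 : ℝ) (2 * r) := by
        rw [Metric.mem_ball, Real.dist_eq] at hx hy
        rw [abs_sub_comm] at hy
        rw [mem_ball_zero_iff, Real.norm_eq_abs]
        linarith [abs_sub_le x x₀ y]
      rw [Set.indicator_of_mem hy, Set.indicator_of_mem this]
    · rw [Set.indicator_of_notMem hy]
      exact zero_le
  have hsymm : ∀ x y, k (x, y) = k (y, x) := fun x y => by
    simp only [hk]
    rw [← enorm_neg, neg_sub]
  have hAy : ∀ᵐ y ∂μ, ∫⁻ x, k (x, y) ^ m ∂μ ≤ maximalConst α C₁ C₂ r β κ s m := by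
    refine hAx.mono fun y hy => ?_
    simpa only [hsymm _ y] using hy
  have hmain := lintegral_enorm_rpow_le_of_kernel hm hEm hDL hED hg hkm hkb hAx hAy
  refine le_of_eq_of_le (lintegral_congr fun x => ?_) hmain
  congr 2
  rw [truncIntegral, intervalIntegral.integral_of_le (by linarith [hρ0 x]),
    ← integral_indicator measurableSet_Ioc]
  congr 1
  funext ξ
  by_cases hx : ξ ∈ Set.Ioc (-ρ x) (ρ x)
  · simp only [hE, Set.indicator_of_mem hx]
    rw [mul_assoc, weight_inv_mul_sobolevWeight]
  · simp only [hE, Set.indicator_of_notMem hx, zero_mul]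

/-- The maximal estimate for countably many times and truncations. -/
theorem lintegral_iSup_truncIntegral_le (hα : 0 < α) (hC₁ : 0 < C₁) (hC₂ : 0 < C₂)
    (hexp : AdmissibleExponents α β κ s m) (hγ : IsTangentialCurve α C₁ C₂ x₀ r γ)
    {t R : ℕ → ℝ} (ht : ∀ n, t n ∈ Set.Icc (0 : ℝ) 1) (hR : ∀ n, 0 ≤ R n) {g : ℝ → ℂ}
    (hg : MemLp (sobolevWeight s g) 2 volume) :
    ∫⁻ x in Metric.ball x₀ r, (⨆ n, ‖truncIntegral g (γ x (t n)) (t n) (R n)‖ₑ) ^ (2 * m) ≤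
      maximalConst α C₁ C₂ r β κ s m * (∫⁻ ξ, ‖sobolevWeight s g ξ‖ₑ ^ 2) ^ m := by
  have hm := hexp.one_le
  have hs0 : 0 ≤ s := by linarith [hexp.half_le, hexp.kappa_lt]
  have hball : MeasurableSet (Metric.ball x₀ r) := Metric.isOpen_ball.measurableSet
  set γ' : ℕ → ℝ → ℝ := fun n => (Metric.ball x₀ r).indicator fun x => γ x (t n) with hγ'
  have hγm : ∀ n, Measurable (γ' n) := fun n => by
    classical
    simp only [hγ', ← Set.piecewise_eq_indicator]
    exact (hγ.continuousOn_left hC₁.le (ht n)).measurable_piecewise continuousOn_const hball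
  have hcont := continuous_truncIntegral
    ((memLp_of_memLp_sobolevWeight hs0 hg).locallyIntegrable one_le_two)
  set F : ℕ → ℝ → ℝ≥0∞ := fun n x => ‖truncIntegral g (γ' n x) (t n) (R n)‖ₑ with hF
  have hFm : ∀ n, Measurable (F n) := fun n =>
    (hcont.measurable.comp (((hγm n).prodMk measurable_const).prodMk measurable_const)).enorm
  have hcongr : ∫⁻ x in Metric.ball x₀ r,
      (⨆ n, ‖truncIntegral g (γ x (t n)) (t n) (R n)‖ₑ) ^ (2 * m) =
      ∫⁻ x in Metric.ball x₀ r, (⨆ n, ⨆ j ≤ n, F j x) ^ (2 * m) := by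
    refine setLIntegral_congr_fun hball fun x hx => ?_
    congr 1
    rw [biSup_le_eq_iSup]
    simp only [hF, hγ', Set.indicator_of_mem hx]
  have hmono : Monotone fun n x => (⨆ j ≤ n, F j x) ^ (2 * m) := fun n n' hn x => by
    apply ENNReal.rpow_le_rpow _ (by linarith)
    exact biSup_mono fun j hj => hj.trans hn
  have hsup : ∀ x, (⨆ n, ⨆ j ≤ n, F j x) ^ (2 * m) = ⨆ n, (⨆ j ≤ n, F j x) ^ (2 * m) := fun x =>
    (ENNReal.orderIsoRpow (2 * m) (by linarith)).map_iSup _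
  rw [hcongr]
  simp only [hsup]
  rw [lintegral_iSup (fun n => (Measurable.iSup fun j => Measurable.iSup fun _ =>
    hFm j).pow_const _) hmono]
  refine iSup_le fun n => ?_
  obtain ⟨ι, hι, hιn, hmax⟩ := exists_measurable_argmax hFm n
  have hsum : ∀ x, R (ι x) ≤ ∑ j ∈ Finset.range (n + 1), R j := fun x =>
    Finset.single_le_sum (fun j _ => hR j) (Finset.mem_range_succ_iff.mpr (hιn x))
  refine le_trans (lintegral_mono fun x => ?_) (lintegral_truncIntegral_linearized_le hα hC₁ hC₂
    hexp hγ (a := fun x => γ' (ι x) x) (τ := fun x => t (ι x)) (ρ := fun x => R (ι x))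
    ((measurable_from_prod_countable_right (f := fun q : ℕ × ℝ => γ' q.1 q.2) hγm).comp
      (hι.prodMk measurable_id)) (measurable_from_nat.comp hι) (measurable_from_nat.comp hι)
    (fun x hx => by simp only [hγ', Set.indicator_of_mem hx]) (fun x => ht _) (fun x => hR _)
    hsum hg)
  apply ENNReal.rpow_le_rpow _ (by linarith)
  exact iSup₂_le fun j hj => hmax x j hj

end

lemma memLp_mul_fourier_of_memH {s : ℝ} (hs : 0 ≤ s) {f : Lp ℂ 2 (volume : Measure ℝ)}
    (hf : MemH s f) :
    MemLp (fun x : ℝ => (((1 + ‖x‖ ^ 2) ^ (s / 2) : ℝ) : ℂ) *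
      (𝓕 f : Lp ℂ 2 (volume : Measure ℝ)) x) 2 volume := by
  obtain ⟨f', hf'⟩ := TemperedDistribution.memSobolev_iff_exists_smulLeftCLM_fourier.mp hf
  rw [Lp.fourier_toTemperedDistribution_eq] at hf'
  have hw : MemLp (fun x : ℝ => (((1 + ‖x‖ ^ 2) ^ (-(s / 2)) : ℝ) : ℂ)) ∞ volume := by
    have hc : Continuous fun x : ℝ => (((1 + ‖x‖ ^ 2) ^ (-(s / 2)) : ℝ) : ℂ) := by
      simp only [Real.norm_eq_abs, sq_abs]
      exact Complex.continuous_ofReal.comp (continuous_one_add_sq_rpow _)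
    refine memLp_top_of_bound hc.aestronglyMeasurable 1 (ae_of_all _ fun x => ?_)
    rw [Complex.norm_real, Real.norm_of_nonneg (by positivity)]
    exact one_add_sq_rpow_neg_le_one (by linarith) _
  have hinj : Function.Injective (Lp.toTemperedDistributionCLM ℂ (volume : Measure ℝ) 2) :=
    LinearMap.ker_eq_bot.mp (Lp.ker_toTemperedDistributionCLM_eq_bot)
  have heq : (hw.toLp _ • f' : Lp ℂ 2 (volume : Measure ℝ)) = 𝓕 f := by
    apply hinj
    rw [Lp.toTemperedDistributionCLM_apply, Lp.toTemperedDistributionCLM_apply,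
      Lp.toTemperedDistribution_smul_eq (by fun_prop), ← hf',
      TemperedDistribution.smulLeftCLM_smulLeftCLM_apply (by fun_prop) (by fun_prop)]
    convert! TemperedDistribution.smulLeftCLM_const 1
      (Lp.toTemperedDistribution (𝓕 f)) using 1
    · congr 2
      ext x
      rw [Pi.mul_apply, ← Complex.ofReal_mul, ← Real.rpow_add (by positivity)]
      simp
    · simp
  refine (Lp.memLp f').ae_eq ?_
  rw [← heq]
  filter_upwards [Lp.coeFn_lpSMul (r := 2) (hw.toLp _) f', hw.coeFn_toLp] with x h1 h2
  rw [h1, Pi.smul_apply', h2, smul_eq_mul, ← mul_assoc, ← Complex.ofReal_mul,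
    ← Real.rpow_add (by positivity)]
  simp

lemma memLp_sobolevWeight_fhat {s : ℝ} (hs : 0 ≤ s) {f : Lp ℂ 2 (volume : Measure ℝ)}
    (hf : MemH s f) : MemLp (sobolevWeight s (fhat f)) 2 volume := by
  have hpi : (2 * Real.pi) ≠ 0 := by positivity
  have h2pi : 1 ≤ 2 * Real.pi := by linarith [Real.pi_gt_three]
  set h := fun x : ℝ => (((1 + ‖x‖ ^ 2) ^ (s / 2) : ℝ) : ℂ) *
      (𝓕 f : Lp ℂ 2 (volume : Measure ℝ)) x with hh
  have hL : MemLp h 2 volume := memLp_mul_fourier_of_memH hs hf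
  have hqmp : Measure.QuasiMeasurePreserving (fun ξ : ℝ => ξ / (2 * Real.pi)) volume volume := by
    refine ⟨by fun_prop, ?_⟩
    simp only [div_eq_mul_inv]
    rw [Real.map_volume_mul_right (inv_ne_zero hpi)]
    exact Measure.smul_absolutelyContinuous
  have hscale : MemLp (fun ξ => h (ξ / (2 * Real.pi))) 2 volume := by
    have hm := hL.1.comp_quasiMeasurePreserving hqmp
    refine (memLp_two_iff_integrable_sq_norm hm).mpr ?_
    exact ((memLp_two_iff_integrable_sq_norm hL.1).mp hL).comp_div hpi
  have hmeas : AEStronglyMeasurable (sobolevWeight s (fhat f)) volume :=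
    (Complex.continuous_ofReal.comp (continuous_one_add_sq_rpow _)).aestronglyMeasurable.mul
      ((Lp.aestronglyMeasurable _).comp_quasiMeasurePreserving hqmp)
  refine (hscale.const_mul (((2 * Real.pi) ^ s : ℝ) : ℂ)).mono hmeas (ae_of_all _ fun ξ => ?_)
  simp only [sobolevWeight, fhat, hh, norm_mul, Complex.norm_real]
  rw [← mul_assoc]
  gcongr
  rw [Real.norm_of_nonneg (by positivity), Real.norm_of_nonneg (by positivity),
    Real.norm_of_nonneg (by positivity)]
  have h1 : (2 * Real.pi) ^ s = ((2 * Real.pi) ^ 2) ^ (s / 2) := by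
    rw [← Real.rpow_natCast_mul (by positivity)]
    congr 1
    push_cast
    ring
  rw [h1, ← Real.mul_rpow (by positivity) (by positivity)]
  gcongr
  rw [Real.norm_eq_abs, sq_abs, div_pow, mul_add, mul_one, mul_div_cancel₀ _ (pow_ne_zero 2 hpi)]
  gcongr
  exact one_le_pow₀ h2pi

lemma truncIntegral_eq_integral_indicator (g : ℝ → ℂ) (a t : ℝ) {R : ℝ} (hR : 0 ≤ R) :
    truncIntegral g a t R = ∫ ξ, (Set.Ioc (-R) R).indicator (fun ξ => chirp a t ξ * g ξ) ξ := by
  rw [truncIntegral, intervalIntegral.integral_of_le (by linarith),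
    integral_indicator measurableSet_Ioc]

lemma truncIntegral_indicator_compl {g : ℝ → ℂ} (hg : LocallyIntegrable g volume) (a t : ℝ)
    {N R : ℝ} (hN : 0 ≤ N) (hNR : N ≤ R) :
    truncIntegral ((Set.Ioc (-N) N)ᶜ.indicator g) a t R =
      truncIntegral g a t R - truncIntegral g a t N := by
  have hint : ∀ R, Integrable ((Set.Ioc (-R) R).indicator fun ξ => chirp a t ξ * g ξ) volume :=
    fun R => by
      rw [integrable_indicator_iff measurableSet_Ioc]
      have h1 : IntegrableOn g (Set.Icc (-R) R) := hg.integrableOn_isCompact isCompact_Icc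
      exact (h1.continuousOn_mul (continuous_chirp_right a t).continuousOn isCompact_Icc).mono_set
        Set.Ioc_subset_Icc_self
  rw [truncIntegral_eq_integral_indicator _ _ _ (hN.trans hNR),
    truncIntegral_eq_integral_indicator _ _ _ (hN.trans hNR),
    truncIntegral_eq_integral_indicator _ _ _ hN, ← integral_sub (hint R) (hint N)]
  congr 1
  funext ξ
  by_cases h1 : ξ ∈ Set.Ioc (-N) N
  · have h2 : ξ ∈ Set.Ioc (-R) R := ⟨by linarith [h1.1], by linarith [h1.2]⟩
    have h3 : ξ ∉ (Set.Ioc (-N) N)ᶜ := fun h => h h1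
    simp only [Set.indicator_of_mem h1, Set.indicator_of_mem h2, Set.indicator_of_notMem h3]
    ring
  · have h3 : ξ ∈ (Set.Ioc (-N) N)ᶜ := h1
    rw [Set.indicator_of_notMem h1, sub_zero]
    simp only [Set.indicator, h3, if_true]

lemma sobolevWeight_indicator (s : ℝ) (S : Set ℝ) (g : ℝ → ℂ) :
    sobolevWeight s (S.indicator g) = S.indicator (sobolevWeight s g) := by
  funext ξ
  by_cases h : ξ ∈ S <;> simp [sobolevWeight, h]

lemma tendsto_lintegral_sobolevWeight_tail {s : ℝ} {g : ℝ → ℂ}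
    (hg : MemLp (sobolevWeight s g) 2 volume) :
    Tendsto (fun N : ℕ => ∫⁻ ξ, ‖sobolevWeight s ((Set.Ioc (-(N : ℝ)) N)ᶜ.indicator g) ξ‖ₑ ^ 2)
      atTop (𝓝 0) := by
  have hfin : ∫⁻ ξ, ‖sobolevWeight s g ξ‖ₑ ^ 2 ≠ ∞ := by
    have := hg.2
    rw [eLpNorm_lt_top_iff_lintegral_rpow_enorm_lt_top (by norm_num) (by norm_num)] at this
    simpa using this.ne
  have h0 : (0 : ℝ≥0∞) = ∫⁻ _ : ℝ, 0 := by simp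
  rw [h0]
  refine tendsto_lintegral_of_dominated_convergence' (fun ξ => ‖sobolevWeight s g ξ‖ₑ ^ 2)
    (fun N => ?_) (fun N => ae_of_all _ fun ξ => ?_) hfin (ae_of_all _ fun ξ => ?_)
  · rw [sobolevWeight_indicator]
    exact ((hg.1.indicator measurableSet_Ioc.compl).enorm).pow_const 2
  · rw [sobolevWeight_indicator]
    exact pow_le_pow_left' (enorm_indicator_le_enorm_self _ _) 2
  · refine tendsto_const_nhds.congr' ?_
    filter_upwards [eventually_gt_atTop ⌈|ξ|⌉₊] with N hN
    have h1 : |ξ| < N := (Nat.le_ceil _).trans_lt (by exact_mod_cast hN)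
    have h2 : ξ ∉ (Set.Ioc (-(N : ℝ)) N)ᶜ := fun h =>
      h ⟨(abs_lt.mp h1).1, (abs_lt.mp h1).2.le⟩
    rw [sobolevWeight_indicator, Set.indicator_of_notMem h2]
    simp

/-- A dense sequence of times and truncation parameters. -/
def denseParam (n : ℕ) : Set.Ioo (0 : ℝ) 1 × Set.Ici (0 : ℝ) :=
  haveI : Nonempty (Set.Ioo (0 : ℝ) 1) := ⟨⟨1 / 2, by norm_num, by norm_num⟩⟩
  TopologicalSpace.denseSeq _ n

lemma denseRange_denseParam : DenseRange denseParam :=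
  haveI : Nonempty (Set.Ioo (0 : ℝ) 1) := ⟨⟨1 / 2, by norm_num, by norm_num⟩⟩
  TopologicalSpace.denseRange_denseSeq _

/-- The maximal function of the truncated integrals over a dense sequence of parameters. -/
def truncMaximal (γ : ℝ → ℝ → ℝ) (g : ℝ → ℂ) (x : ℝ) : ℝ≥0∞ :=
  ⨆ n, ‖truncIntegral g (γ x (denseParam n).1) (denseParam n).1 (denseParam n).2‖ₑ

section

variable {α C₁ C₂ x₀ r : ℝ} {γ : ℝ → ℝ → ℝ}

lemma IsTangentialCurve.continuous_truncIntegral_right (hγ : IsTangentialCurve α C₁ C₂ x₀ r γ)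
    (hα : 0 < α) {g : ℝ → ℂ} (hg : LocallyIntegrable g volume) {x : ℝ}
    (hx : x ∈ Metric.ball x₀ r) :
    Continuous fun q : Set.Ioo (0 : ℝ) 1 × ℝ => truncIntegral g (γ x q.1) q.1 q.2 := by
  have h1 : Continuous fun t : Set.Ioo (0 : ℝ) 1 => γ x t :=
    ((hγ.continuousOn_right hα hx).mono Set.Ioo_subset_Icc_self).domRestrict
  exact (continuous_truncIntegral hg).comp (((h1.comp continuous_fst).prodMk
    (continuous_subtype_val.comp continuous_fst)).prodMk continuous_snd)

lemma IsTangentialCurve.aemeasurable_truncIntegral (hγ : IsTangentialCurve α C₁ C₂ x₀ r γ)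
    (hC₁ : 0 ≤ C₁) {g : ℝ → ℂ} (hg : LocallyIntegrable g volume) {t : ℝ}
    (ht : t ∈ Set.Icc (0 : ℝ) 1) (R : ℝ) :
    AEMeasurable (fun x => truncIntegral g (γ x t) t R)
      (volume.restrict (Metric.ball x₀ r)) := by
  have h1 : Continuous fun a : ℝ => truncIntegral g a t R :=
    (continuous_truncIntegral hg).comp
      (((continuous_id (X := ℝ)).prodMk continuous_const).prodMk continuous_const)
  have h2 : AEMeasurable (fun x => γ x t) (volume.restrict (Metric.ball x₀ r)) :=
    (hγ.continuousOn_left hC₁ ht).aemeasurable Metric.isOpen_ball.measurableSet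
  exact h1.measurable.comp_aemeasurable h2

lemma IsTangentialCurve.enorm_truncIntegral_le_truncMaximal
    (hγ : IsTangentialCurve α C₁ C₂ x₀ r γ) (hα : 0 < α) {g : ℝ → ℂ}
    (hg : LocallyIntegrable g volume) {x : ℝ} (hx : x ∈ Metric.ball x₀ r) {t : ℝ}
    (ht : t ∈ Set.Ioo (0 : ℝ) 1) {R : ℝ} (hR : 0 ≤ R) :
    ‖truncIntegral g (γ x t) t R‖ₑ ≤ truncMaximal γ g x := by
  have hc : Continuous fun q : Set.Ioo (0 : ℝ) 1 × Set.Ici (0 : ℝ) =>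
      ‖truncIntegral g (γ x q.1) q.1 q.2‖ₑ :=
    ((hγ.continuous_truncIntegral_right hα hg hx).comp
      (continuous_fst.prodMk (continuous_subtype_val.comp continuous_snd))).enorm
  exact denseRange_denseParam.induction_on
    (p := fun q => ‖truncIntegral g (γ x q.1) q.1 q.2‖ₑ ≤ truncMaximal γ g x)
    (⟨t, ht⟩, ⟨R, hR⟩) (isClosed_le hc continuous_const)
    fun n => le_iSup (fun n => ‖truncIntegral g (γ x (denseParam n).1) (denseParam n).1
      (denseParam n).2‖ₑ) n

lemma IsTangentialCurve.aemeasurable_truncMaximal (hγ : IsTangentialCurve α C₁ C₂ x₀ r γ)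
    (hC₁ : 0 ≤ C₁) {g : ℝ → ℂ} (hg : LocallyIntegrable g volume) :
    AEMeasurable (truncMaximal γ g) (volume.restrict (Metric.ball x₀ r)) :=
  AEMeasurable.iSup fun n => (hγ.aemeasurable_truncIntegral hC₁ hg
    (Set.Ioo_subset_Icc_self (denseParam n).1.2) _).enorm

variable {β κ s m : ℝ}

theorem lintegral_truncMaximal_le (hα : 0 < α) (hC₁ : 0 < C₁) (hC₂ : 0 < C₂)
    (hexp : AdmissibleExponents α β κ s m) (hγ : IsTangentialCurve α C₁ C₂ x₀ r γ) {g : ℝ → ℂ}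
    (hg : MemLp (sobolevWeight s g) 2 volume) :
    ∫⁻ x in Metric.ball x₀ r, truncMaximal γ g x ^ (2 * m) ≤
      maximalConst α C₁ C₂ r β κ s m * (∫⁻ ξ, ‖sobolevWeight s g ξ‖ₑ ^ 2) ^ m :=
  lintegral_iSup_truncIntegral_le hα hC₁ hC₂ hexp hγ
    (fun n => Set.Ioo_subset_Icc_self (denseParam n).1.2) (fun n => (denseParam n).2.2) hg

/-- For almost every `x` the truncated integrals form a Cauchy net, uniformly in time. -/
theorem ae_uniform_cauchy_truncIntegral (hα : 0 < α) (hC₁ : 0 < C₁) (hC₂ : 0 < C₂) (hr : 0 < r)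
    (hexp : AdmissibleExponents α β κ s m) (hγ : IsTangentialCurve α C₁ C₂ x₀ r γ) {g : ℝ → ℂ}
    (hg : MemLp (sobolevWeight s g) 2 volume) :
    ∀ᵐ x ∂(volume.restrict (Metric.ball x₀ r)), ∀ ε > 0, ∃ N : ℕ, ∀ t ∈ Set.Ioo (0 : ℝ) 1,
      ∀ R, (N : ℝ) ≤ R →
        ‖truncIntegral g (γ x t) t R - truncIntegral g (γ x t) t N‖ ≤ ε := by
  have hm := hexp.one_le
  have hs0 : 0 ≤ s := by linarith [hexp.half_le, hexp.kappa_lt]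
  set tail : ℕ → ℝ → ℂ := fun N => (Set.Ioc (-(N : ℝ)) N)ᶜ.indicator g with htail
  have htailW : ∀ N, MemLp (sobolevWeight s (tail N)) 2 volume := fun N => by
    rw [htail, sobolevWeight_indicator]
    exact hg.indicator measurableSet_Ioc.compl
  have hloc : LocallyIntegrable g volume :=
    (memLp_of_memLp_sobolevWeight hs0 hg).locallyIntegrable one_le_two
  have hlocN : ∀ N, LocallyIntegrable (tail N) volume := fun N =>
    (memLp_of_memLp_sobolevWeight hs0 (htailW N)).locallyIntegrable one_le_two
  have hmeas : AEMeasurable (fun x => ⨅ N, truncMaximal γ (tail N) x)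
      (volume.restrict (Metric.ball x₀ r)) :=
    AEMeasurable.iInf fun N => hγ.aemeasurable_truncMaximal hC₁.le (hlocN N)
  have hlim : Tendsto (fun N : ℕ => maximalConst α C₁ C₂ r β κ s m *
      (∫⁻ ξ, ‖sobolevWeight s (tail N) ξ‖ₑ ^ 2) ^ m) atTop (𝓝 0) := by
    have h1 := (tendsto_lintegral_sobolevWeight_tail hg).ennrpow_const m
    rw [ENNReal.zero_rpow_of_pos (by linarith)] at h1
    have h2 := ENNReal.Tendsto.const_mul h1 (Or.inr (maximalConst_ne_top C₁ C₂ hr hexp))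
    rwa [mul_zero] at h2
  have hzero : ∫⁻ x in Metric.ball x₀ r, (⨅ N, truncMaximal γ (tail N) x) ^ (2 * m) = 0 := by
    refine le_antisymm (ge_of_tendsto' hlim fun N => ?_) zero_le
    refine le_trans (lintegral_mono fun x => ?_)
      (lintegral_truncMaximal_le hα hC₁ hC₂ hexp hγ (htailW N))
    exact ENNReal.rpow_le_rpow (iInf_le _ N) (by linarith)
  rw [lintegral_eq_zero_iff' (hmeas.pow_const _)] at hzero
  filter_upwards [hzero, ae_restrict_mem Metric.isOpen_ball.measurableSet] with x hx0 hx ε hε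
  have hinf : ⨅ N, truncMaximal γ (tail N) x = 0 := by
    simpa using (ENNReal.rpow_eq_zero_iff_of_pos (by linarith)).mp hx0
  obtain ⟨N, hN⟩ := iInf_lt_iff.mp (hinf.trans_lt (ENNReal.ofReal_pos.mpr hε))
  refine ⟨N, fun t ht R hR => ?_⟩
  have h1 := hγ.enorm_truncIntegral_le_truncMaximal hα (hlocN N) hx ht
    ((Nat.cast_nonneg N).trans hR)
  rw [htail] at h1
  simp only at h1
  rw [truncIntegral_indicator_compl hloc _ _ (Nat.cast_nonneg N) hR, ← ofReal_norm] at h1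
  exact (ENNReal.ofReal_le_ofReal_iff hε.le).mp (h1.trans hN.le)

end

lemma schrodingerTrunc_eq (f : Lp ℂ 2 (volume : Measure ℝ)) (t x R : ℝ) :
    schrodingerTrunc f t x R = (2 * Real.pi : ℂ)⁻¹ * truncIntegral (fhat f) x t R := rfl

lemma norm_inv_two_pi_le_one : ‖(2 * Real.pi : ℂ)⁻¹‖ ≤ 1 := by
  have h : (2 * Real.pi : ℂ) = ((2 * Real.pi : ℝ) : ℂ) := by push_cast; rfl
  rw [norm_inv, h, Complex.norm_real, Real.norm_of_nonneg (by positivity)]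
  exact inv_le_one_of_one_le₀ (by linarith [Real.pi_gt_three])

lemma enorm_schrodingerTrunc_le (f : Lp ℂ 2 (volume : Measure ℝ)) (t x R : ℝ) :
    ‖schrodingerTrunc f t x R‖ₑ ≤ ‖truncIntegral (fhat f) x t R‖ₑ := by
  rw [← ofReal_norm, ← ofReal_norm, schrodingerTrunc_eq, norm_mul]
  exact ENNReal.ofReal_le_ofReal
    (mul_le_of_le_one_left (norm_nonneg _) norm_inv_two_pi_le_one)

variable {α C₁ C₂ x₀ r β κ s m : ℝ} {γ : ℝ → ℝ → ℝ} {f : Lp ℂ 2 (volume : Measure ℝ)}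

/-- For almost every `x` the truncations converge to the solution along the curve through `x`,
uniformly in time. -/
theorem ae_tendstoUniformly_schrodingerTrunc (hα : 0 < α) (hC₁ : 0 < C₁) (hC₂ : 0 < C₂)
    (hr : 0 < r) (hexp : AdmissibleExponents α β κ s m) (hγ : IsTangentialCurve α C₁ C₂ x₀ r γ)
    (hf : MemLp (sobolevWeight s (fhat f)) 2 volume) :
    ∀ᵐ x ∂(volume.restrict (Metric.ball x₀ r)), TendstoUniformly
      (fun (R : ℝ) (t : Set.Ioo (0 : ℝ) 1) => schrodingerTrunc f t (γ x t) R)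
      (fun t => schrodinger f t (γ x t)) atTop := by
  filter_upwards [ae_uniform_cauchy_truncIntegral hα hC₁ hC₂ hr hexp hγ hf] with x hx
  have hx' : ∀ ε > 0, ∃ N : ℕ, ∀ t : Set.Ioo (0 : ℝ) 1, ∀ R, (N : ℝ) ≤ R →
      dist (schrodingerTrunc f t (γ x t) R) (schrodingerTrunc f t (γ x t) N) ≤ ε := by
    intro ε hε
    obtain ⟨N, hN⟩ := hx ε hε
    refine ⟨N, fun t R hR => ?_⟩
    rw [dist_eq_norm, schrodingerTrunc_eq, schrodingerTrunc_eq, ← mul_sub, norm_mul]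
    exact (mul_le_of_le_one_left (norm_nonneg _) norm_inv_two_pi_le_one).trans (hN t t.2 R hR)
  have hlim : ∀ t : Set.Ioo (0 : ℝ) 1, Tendsto (schrodingerTrunc f t (γ x t)) atTop
      (𝓝 (schrodinger f t (γ x t))) := by
    intro t
    apply tendsto_nhds_limUnder
    apply cauchy_map_iff_exists_tendsto.mp
    rw [Metric.cauchy_iff]
    refine ⟨inferInstance, fun ε hε => ?_⟩
    obtain ⟨N, hN⟩ := hx' (ε / 3) (by positivity)
    refine ⟨schrodingerTrunc f t (γ x t) '' Set.Ici (N : ℝ), image_mem_map (Ici_mem_atTop _), ?_⟩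
    rintro _ ⟨R, hR, rfl⟩ _ ⟨R', hR', rfl⟩
    have h1 := hN t R hR
    have h2 := hN t R' hR'
    have h3 := dist_triangle_right (schrodingerTrunc f t (γ x t) R)
      (schrodingerTrunc f t (γ x t) R') (schrodingerTrunc f t (γ x t) N)
    linarith
  rw [Metric.tendstoUniformly_iff]
  intro ε hε
  obtain ⟨N, hN⟩ := hx' (ε / 3) (by positivity)
  filter_upwards [eventually_ge_atTop (N : ℝ)] with R hR t
  have h1 : dist (schrodinger f t (γ x t)) (schrodingerTrunc f t (γ x t) N) ≤ ε / 3 :=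
    le_of_tendsto ((hlim t).dist tendsto_const_nhds)
      ((eventually_ge_atTop (N : ℝ)).mono fun R' hR' => hN t R' hR')
  have h2 := hN t R hR
  have h3 := dist_triangle_right (schrodinger f t (γ x t)) (schrodingerTrunc f t (γ x t) R)
    (schrodingerTrunc f t (γ x t) N)
  linarith

/-- The maximal estimate for admissible exponents. -/
theorem maximalEstimate_of_admissibleExponents (hα : 0 < α) (hC₁ : 0 < C₁) (hC₂ : 0 < C₂)
    (hr : 0 < r) (hexp : AdmissibleExponents α β κ s m) {p : ℝ} (hp : 0 < p) (hpm : p ≤ 2 * m) :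
    MaximalEstimate α C₁ C₂ x₀ r s p := by
  have hm := hexp.one_le
  have hs0 : 0 ≤ s := by linarith [hexp.half_le, hexp.kappa_lt]
  have hA := maximalConst_ne_top C₁ C₂ hr hexp
  set A := maximalConst α C₁ C₂ r β κ s m
  set μ := (volume : Measure ℝ).restrict (Metric.ball x₀ r) with hμ
  have hμfin : IsFiniteMeasure μ := ⟨by
    rw [hμ, Measure.restrict_apply_univ]
    exact measure_ball_lt_top⟩
  set C : ℝ≥0∞ := A ^ (1 / (2 * m)) * μ Set.univ ^ (1 / p - 1 / (2 * m)) with hC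
  have hexp0 : 0 ≤ 1 / p - 1 / (2 * m) := sub_nonneg.mpr (one_div_le_one_div_of_le hp hpm)
  have hCtop : C ≠ ∞ := ENNReal.mul_ne_top (ENNReal.rpow_ne_top_of_nonneg (by positivity) hA)
    (ENNReal.rpow_ne_top_of_nonneg hexp0 (measure_ne_top μ _))
  refine ⟨C.toNNReal, fun γ hγ f hf => ?_⟩
  have hW := memLp_sobolevWeight_fhat hs0 hf
  have hloc : LocallyIntegrable (fhat f) volume :=
    (memLp_of_memLp_sobolevWeight hs0 hW).locallyIntegrable one_le_two
  have hunif := ae_tendstoUniformly_schrodingerTrunc hα hC₁ hC₂ hr hexp hγ hW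
  have hball : ∀ᵐ x ∂μ, x ∈ Metric.ball x₀ r :=
    ae_restrict_mem Metric.isOpen_ball.measurableSet
  have hconv : ∀ᵐ x ∂μ, ∀ t ∈ Set.Ioo (0 : ℝ) 1,
      Tendsto (schrodingerTrunc f t (γ x t)) atTop (𝓝 (schrodinger f t (γ x t))) :=
    hunif.mono fun x hx t ht => hx.tendsto_at ⟨t, ht⟩
  have hmeas : AEMeasurable (maximalFunction γ f) μ := by
    have hcount : maximalFunction γ f =ᵐ[μ]
        fun x => ⨆ n, ‖schrodinger f (denseParam n).1 (γ x (denseParam n).1)‖ₑ := by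
      filter_upwards [hunif, hball] with x hx hxb
      have hc : Continuous fun t : Set.Ioo (0 : ℝ) 1 => schrodinger f t (γ x t) := by
        refine hx.continuous (Frequently.of_forall fun R => ?_)
        exact continuous_const.mul ((hγ.continuous_truncIntegral_right hα hloc hxb).comp
          (continuous_id.prodMk continuous_const))
      refine le_antisymm (iSup₂_le fun t ht => ?_) (iSup_le fun n => ?_)
      · exact denseRange_denseParam.induction_on
          (p := fun q => ‖schrodinger f q.1 (γ x q.1)‖ₑ ≤
            ⨆ n, ‖schrodinger f (denseParam n).1 (γ x (denseParam n).1)‖ₑ)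
          (⟨t, ht⟩, ⟨0, Set.self_mem_Ici⟩) (isClosed_le (hc.comp continuous_fst).enorm continuous_const)
          fun n => le_iSup
            (fun n => ‖schrodinger f (denseParam n).1 (γ x (denseParam n).1)‖ₑ) n
      · exact le_iSup₂ (f := fun (t : ℝ) (_ : t ∈ Set.Ioo (0 : ℝ) 1) =>
          ‖schrodinger f t (γ x t)‖ₑ) ((denseParam n).1 : ℝ) (denseParam n).1.2
    refine AEMeasurable.congr (AEMeasurable.iSup fun n => ?_) hcount.symm
    refine AEMeasurable.enorm ?_
    refine aemeasurable_of_tendsto_metrizable_ae (ι := ℕ) atTop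
      (f := fun k x => schrodingerTrunc f (denseParam n).1 (γ x (denseParam n).1) k)
      (fun k => (hγ.aemeasurable_truncIntegral hC₁.le hloc
        (Set.Ioo_subset_Icc_self (denseParam n).1.2) k).const_mul _) ?_
    exact hconv.mono fun x hx => (hx _ (denseParam n).1.2).comp tendsto_natCast_atTop_atTop
  refine ⟨hconv, hmeas, ?_⟩
  have hle : ∀ᵐ x ∂μ, maximalFunction γ f x ≤ truncMaximal γ (fhat f) x := by
    filter_upwards [hconv, hball] with x hx hxb
    refine iSup₂_le fun t ht => le_of_tendsto (hx t ht).enorm ?_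
    filter_upwards [eventually_ge_atTop (0 : ℝ)] with R hR
    exact (enorm_schrodingerTrunc_le f t _ R).trans
      (hγ.enorm_truncIntegral_le_truncMaximal hα hloc hxb ht hR)
  have hnorm : normH s f = (∫⁻ ξ, ‖sobolevWeight s (fhat f) ξ‖ₑ ^ 2) ^ (1 / 2 : ℝ) := by
    have : normH s f = eLpNorm (sobolevWeight s (fhat f)) 2 volume := rfl
    rw [this, eLpNorm_eq_lintegral_rpow_enorm_toReal (by norm_num) (by norm_num)]
    simp
  have hm0 : (2 * m) ≠ 0 := by positivity
  have hL : eLpNorm (maximalFunction γ f) (ENNReal.ofReal (2 * m)) μ ≤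
      A ^ (1 / (2 * m)) * normH s f := by
    rw [eLpNorm_eq_lintegral_rpow_enorm_toReal (by simpa using by linarith) ENNReal.ofReal_ne_top,
      ENNReal.toReal_ofReal (by linarith), hnorm]
    simp only [enorm_eq_self]
    calc (∫⁻ x, maximalFunction γ f x ^ (2 * m) ∂μ) ^ (1 / (2 * m))
        ≤ (A * (∫⁻ ξ, ‖sobolevWeight s (fhat f) ξ‖ₑ ^ 2) ^ m) ^ (1 / (2 * m)) := by
          refine ENNReal.rpow_le_rpow ?_ (by positivity)
          refine le_trans (lintegral_mono_ae (hle.mono fun x hx => ?_))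
            (lintegral_truncMaximal_le hα hC₁ hC₂ hexp hγ hW)
          exact ENNReal.rpow_le_rpow hx (by linarith)
      _ = _ := by
          rw [ENNReal.mul_rpow_of_nonneg _ _ (by positivity), ← ENNReal.rpow_mul]
          congr 2
          field_simp
  calc eLpNorm (maximalFunction γ f) (ENNReal.ofReal p) μ
      ≤ eLpNorm (maximalFunction γ f) (ENNReal.ofReal (2 * m)) μ *
        μ Set.univ ^ (1 / (ENNReal.ofReal p).toReal - 1 / (ENNReal.ofReal (2 * m)).toReal) :=
        eLpNorm_le_eLpNorm_mul_rpow_measure_univ (ENNReal.ofReal_le_ofReal hpm)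
          hmeas.aestronglyMeasurable
    _ ≤ A ^ (1 / (2 * m)) * normH s f * μ Set.univ ^ (1 / p - 1 / (2 * m)) := by
        rw [ENNReal.toReal_ofReal hp.le, ENNReal.toReal_ofReal (by linarith)]
        gcongr
    _ = C * normH s f := by rw [hC]; ring
    _ = C.toNNReal * normH s f := by rw [ENNReal.coe_toNNReal hCtop]

lemma exists_admissibleExponents (hα : 0 < α) (hm : 1 ≤ m) (hαm : 2 * α ≤ m) (hs : 1 / 4 < s)
    (h₁ : (1 - 2 * s) * m < 1) (h₂ : (1 - 2 * s) * m < 2 * α) :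
    ∃ β κ, AdmissibleExponents α β κ s m := by
  have hm0 : 0 < m := by linarith
  have hlt : max 0 (max (1 - 2 * s) ((1 - 2 * s) / (2 * α))) < 1 / m := by
    refine max_lt (by positivity) (max_lt ?_ ?_)
    · rwa [lt_div_iff₀ hm0]
    · rw [div_lt_div_iff₀ (by positivity) hm0]
      linarith
  obtain ⟨β, hβ, hβm⟩ := exists_between hlt
  obtain ⟨hβ0, hβ'⟩ := max_lt_iff.mp hβ
  obtain ⟨hβ1, hβ2⟩ := max_lt_iff.mp hβ'
  rw [div_lt_iff₀ (by positivity)] at hβ2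
  rw [lt_div_iff₀ hm0] at hβm
  refine ⟨β, max (1 / 2) (max (1 - β) (1 - 2 * α * β)), hm, hβ0, hβm, ?_, le_max_left _ _,
    (le_max_left _ _).trans (le_max_right _ _), (le_max_right _ _).trans (le_max_right _ _), ?_⟩
  · nlinarith
  · rw [div_lt_iff₀ two_pos]
    exact max_lt (by linarith) (max_lt (by linarith) (by linarith))

end TangentialSchrodinger

end

theorem mainTheorem4 (α C₁ C₂ x₀ r : ℝ) (hα₀ : 0 < α) (hα₁ : α < 1) (hC₁ : 1 ≤ C₁) (hC₂ : 0 < C₂)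
    (hr : 0 < r) :
    (1 / 2 ≤ α → ∀ s p : ℝ, 1 / 4 < s → 0 < p → p ≤ 4 →
      TangentialSchrodinger.MaximalEstimate α C₁ C₂ x₀ r s p) ∧
    (1 / 4 < α → α < 1 / 2 → ∀ s p : ℝ, 1 / 4 < s → 0 < p → p ≤ 8 * α →
      TangentialSchrodinger.MaximalEstimate α C₁ C₂ x₀ r s p) ∧
    (α ≤ 1 / 4 → ∀ s p : ℝ, 1 / 2 - α < s → 0 < p → p ≤ 2 →
      TangentialSchrodinger.MaximalEstimate α C₁ C₂ x₀ r s p) := by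
  have hC₁' : 0 < C₁ := by linarith
  refine ⟨fun h s p hs hp hp4 => ?_, fun h h' s p hs hp hp8 => ?_, fun h s p hs hp hp2 => ?_⟩
  · obtain ⟨β, κ, hexp⟩ := TangentialSchrodinger.exists_admissibleExponents (s := s) (m := 2) hα₀
      (by norm_num) (by linarith) hs (by linarith) (by linarith)
    exact TangentialSchrodinger.maximalEstimate_of_admissibleExponents hα₀ hC₁' hC₂ hr hexp hp
      (by linarith)
  · obtain ⟨β, κ, hexp⟩ := TangentialSchrodinger.exists_admissibleExponents (s := s) (m := 4 * α)
      hα₀ (by linarith) (by linarith) hs (by nlinarith) (by nlinarith)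
    exact TangentialSchrodinger.maximalEstimate_of_admissibleExponents hα₀ hC₁' hC₂ hr hexp hp
      (by linarith)
  · obtain ⟨β, κ, hexp⟩ := TangentialSchrodinger.exists_admissibleExponents (s := s) (m := 1) hα₀
      le_rfl (by linarith) (by linarith) (by linarith) (by linarith)
    exact TangentialSchrodinger.maximalEstimate_of_admissibleExponents hα₀ hC₁' hC₂ hr hexp hp
      (by linarith)
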